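/- **Proposition 3.3.** Let $X$ be a metric space whose topology is discrete and which is proper (closed bounded subsets are compact), and let $\mathscr H$ be an infinite-dimensional separable complex Hilbert space. Let $\mathcal H_X$ be an ample $X$-module, that is, an infinite-dimensional separable complex Hilbert space with a non-degenerate $*$-representation of $C_0(X)$ for which no non-zero element of $C_0(X)$ acts as a compact operator. For $A\subseteq X$ let $\chi_A\in\mathfrak B(\mathcal H_X)$ be the projection given by the indicator function of $A$ under the extension of the representation to bounded Borel functions. An operator $T\in\mathfrak B(\mathcal H_X)$ is * *locally compact* if $fT$ and $Tf$ are compact for all $f\in C_0(X)$; * *of finite propagation* if $\sup\{d(x,y):(x,y)\in\operatorname{supp}T\}<\infty$, where $\operatorname{supp}T$ is the set of $(y,x)\in X\times X$ such that $\chi_VT\chi_U\neq0$ for all neighbourhoods $U$ of $x$ and $V$ of $y$; * *quasi-local* if for every $\varepsilon>0$ there is $R>0$ such that $\|\chi_AT\chi_B\|<\varepsilon$ for all $A,B\subseteq X$ with $d(A,B)\ge R$; * *strongly quasi-local* if for every $\varepsilon>0$ there are $\delta,R>0$ such that $\|[T\otimes\mathrm{Id}_{\mathscr H},\Lambda(g)]\|<\varepsilon$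 for every map $g$ from $X$ to the closed unit ball of the compact operators on $\mathscr H$ such that $\|g(x)-g(y)\|<\delta$ whenever $d(x,y)<R$. Here $\Lambda(g)$ is the block-diagonal operator on $\mathcal H_X\otimes\mathscr H=\bigoplus_{x\in X}\chi_{\{x\}}\mathcal H_X\otimes\mathscr H$ that acts as $\mathrm{Id}\otimes g(x)$ on the summand of $x$. Let $C^*(\mathcal H_X)$ (the Roe algebra) be the operator norm closure of the set of locally compact operators of finite propagation, and let $C^*_q(\mathcal H_X)$ and $C^*_{sq}(\mathcal H_X)$ be the sets of all locally compact operators that are quasi-local, respectively strongly quasi-local. Then: 1. $C^*_{sq}(\mathcal H_X)\subseteq C^*_q(\mathcal H_X)$. 2. If $X$ has bounded geometry (for every $r>0$ there is $N\in\mathbb N$ such that every open ball of radius $r$ has at most $N$ points), then $C^*(\mathcal H_X)\subseteq C^*_{sq}(\mathcal H_X)$. 3. If $X$ has bounded geometry and Yu's property A, then $C^*(\mathcal H_X)=C^*_{sq}(\mathcal H_X)=C^*_q(\mathcal H_X)$. Property A means: for all $r,\varepsilon>0$ there are finite sets $A_x\subseteq X\times\mathbb N$ ($x\in X$) and $S>0$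 such that $(x,1)\in A_x$ for all $x$; $A_x\cap A_y\ne\emptyset$ and $\#(A_x\triangle A_y)/\#(A_x\cap A_y)<\varepsilon$ whenever $d(x,y)\le r$; and $d(y,z)\le S$ whenever $(y,m),(z,n)\in A_x$ for some $x\in X$ and $m,n\in\mathbb N$. -/

import Mathlib

open scoped ZeroAtInfty TensorProduct ENNReal

noncomputable section

namespace RoeQL

/-! ### Coarse geometry -/

section CoarseGeometry

/-- Bounded geometry: for every `r > 0` the open `r`-balls have uniformly bounded cardinality. -/
def BoundedGeometry (X : Type*) [MetricSpace X] : Prop :=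
  ∀ r : ℝ, 0 < r → ∃ N : ℕ, ∀ x : X, (Metric.ball x r).encard ≤ N

/-- Yu's property A: for all `r, ε > 0` there are finite sets `A x ⊆ X × ℕ` with `(x, 1) ∈ A x`,
with `#(A x ∆ A y) / #(A x ∩ A y) < ε` whenever `d(x, y) ≤ r`, and whose projections to `X` have
uniformly bounded diameter. (The quotient is cleared: the inequality forces
`A x ∩ A y` to be nonempty.) -/
def PropertyA (X : Type*) [MetricSpace X] : Prop :=
  ∀ r ε : ℝ, 0 < r → 0 < ε → ∃ A : X → Set (X × ℕ),
    (∀ x, (A x).Finite) ∧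
    (∀ x, (x, 1) ∈ A x) ∧
    (∀ x y, dist x y ≤ r →
      ((symmDiff (A x) (A y)).ncard : ℝ) < ε * ((A x ∩ A y).ncard : ℝ)) ∧
    ∃ R : ℝ, 0 < R ∧ ∀ z, ∀ p ∈ A z, ∀ q ∈ A z, dist p.1 q.1 ≤ R

/-- `g` has `(δ, R)`-variation. -/
def HasVariation {X Y : Type*} [MetricSpace X] [MetricSpace Y] (g : X → Y) (δ R : ℝ) : Prop :=
  ∀ x y, dist x y < R → dist (g x) (g y) < δ

end CoarseGeometry

/-! ### Modules over a space -/

/-- A non-degenerate `*`-representation of `C₀(X)` on the Hilbert space `H`. -/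
structure XModule (X : Type*) [MetricSpace X]
    (H : Type*) [NormedAddCommGroup H] [InnerProductSpace ℂ H] [CompleteSpace H] where
  rep : C₀(X, ℂ) →⋆ₙₐ[ℂ] (H →L[ℂ] H)
  nondegenerate :
    (Submodule.span ℂ {v : H | ∃ f ξ, v = rep f ξ}).topologicalClosure = ⊤

namespace XModule

variable {X : Type*} [MetricSpace X]
  {H : Type*} [NormedAddCommGroup H] [InnerProductSpace ℂ H] [CompleteSpace H]
  (M : XModule X H)

/-- No non-zero element of `C₀(X)` acts as a compact operator. -/
def IsAmple : Prop := ∀ f : C₀(X, ℂ), IsCompactOperator (M.rep f) → f = 0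

/-- The closed linear span of `C₀(X)`-translates `f · ξ` with `f` vanishing off `A`. -/
def subspace (A : Set X) : Submodule ℂ H :=
  (Submodule.span ℂ {v : H | ∃ f ξ, (∀ x ∉ A, f x = 0) ∧ v = M.rep f ξ}).topologicalClosure

instance (A : Set X) : CompleteSpace (M.subspace A) :=
  (Submodule.isClosed_topologicalClosure _).completeSpace_coe

/-- The operator `χ_A` on `H`. For a discrete `X` (where every subset is open, hence Borel), the
extension of the representation to bounded Borel functions sends the indicator of `A` to the
orthogonal projection onto `M.subspace A`. -/
def chi (A : Set X) : H →L[ℂ] H := (M.subspace A).starProjection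

/-- The support of an operator. -/
def support (T : H →L[ℂ] H) : Set (X × X) :=
  {p | ∀ V ∈ nhds p.1, ∀ U ∈ nhds p.2, M.chi V ∘L T ∘L M.chi U ≠ 0}

/-- The propagation of an operator, in `[0, ∞]`. -/
def propagation (T : H →L[ℂ] H) : ℝ≥0∞ := ⨆ p ∈ M.support T, edist p.1 p.2

/-- `fT` and `Tf` are compact for all `f ∈ C₀(X)`. -/
def IsLocallyCompact (T : H →L[ℂ] H) : Prop :=
  ∀ f : C₀(X, ℂ), IsCompactOperator (M.rep f ∘L T) ∧ IsCompactOperator (T ∘L M.rep f)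

/-- The algebraic Roe algebra: locally compact operators of finite propagation. -/
def algebraicRoe : Set (H →L[ℂ] H) :=
  {T | M.IsLocallyCompact T ∧ M.propagation T < ⊤}

/-- The Roe algebra: the closure of the algebraic Roe algebra in operator norm. -/
def roe : Set (H →L[ℂ] H) := closure M.algebraicRoe

/-- `(ε, R)`-propagation of an operator (over a discrete space, all subsets are Borel). The
inequality `R ≤ d(A, B)` is spelled out pointwise, so that it holds if `A` or `B` is empty. -/
def HasPropagation (T : H →L[ℂ] H) (ε R : ℝ) : Prop :=
  ∀ A B : Set X, (∀ a ∈ A, ∀ b ∈ B, R ≤ dist a b) → ‖M.chi A ∘L T ∘L M.chi B‖ < ε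

def IsQuasiLocal (T : H →L[ℂ] H) : Prop :=
  ∀ ε : ℝ, 0 < ε → ∃ R : ℝ, 0 < R ∧ M.HasPropagation T ε R

/-- The quasi-local algebra. -/
def quasiLocal : Set (H →L[ℂ] H) := {T | M.IsLocallyCompact T ∧ M.IsQuasiLocal T}

end XModule

/-! ### Hilbert space tensor products -/

section Tensor

variable {H : Type*} [NormedAddCommGroup H] [InnerProductSpace ℂ H]
  {K : Type*} [NormedAddCommGroup K] [InnerProductSpace ℂ K]

/-- The Hilbert space tensor product: the completion of the algebraic one for the inner product
`⟪a ⊗ b, c ⊗ d⟫ = ⟪a, c⟫ ⟪b, d⟫`. -/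
abbrev HTensor (H K : Type*) [NormedAddCommGroup H] [InnerProductSpace ℂ H]
    [NormedAddCommGroup K] [InnerProductSpace ℂ K] : Type _ :=
  UniformSpace.Completion (H ⊗[ℂ] K)

/-- The bounded operator `T ⊗ S` on the Hilbert space tensor product. -/
def tensorOp (T : H →L[ℂ] H) (S : K →L[ℂ] K) : HTensor H K →L[ℂ] HTensor H K :=
  (TensorProduct.mapL T S).completion

theorem tensorOp_coe (T : H →L[ℂ] H) (S : K →L[ℂ] K) (u : H ⊗[ℂ] K) :
    tensorOp T S (u : HTensor H K) = (TensorProduct.mapL T S u : H ⊗[ℂ] K) := by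
  simp [tensorOp]

theorem tensorOp_comp (T T' : H →L[ℂ] H) (S S' : K →L[ℂ] K) (v : HTensor H K) :
    tensorOp T S (tensorOp T' S' v) = tensorOp (T ∘L T') (S ∘L S') v := by
  induction v using UniformSpace.Completion.induction_on with
  | hp => exact isClosed_eq (by fun_prop) (by fun_prop)
  | ih u => simp only [tensorOp_coe, TensorProduct.mapL_comp]; rfl

theorem norm_tensorOp_le (T : H →L[ℂ] H) (S : K →L[ℂ] K) (v : HTensor H K) :
    ‖tensorOp T S v‖ ≤ ‖T‖ * ‖S‖ * ‖v‖ := by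
  induction v using UniformSpace.Completion.induction_on with
  | hp => exact isClosed_le (by fun_prop) (by fun_prop)
  | ih u =>
    rw [tensorOp_coe, UniformSpace.Completion.norm_coe, UniformSpace.Completion.norm_coe]
    exact (TensorProduct.mapL T S).le_of_opNorm_le (TensorProduct.norm_mapL_le T S) u

theorem tensorOp_zero_left (S : K →L[ℂ] K) : tensorOp (0 : H →L[ℂ] H) S = 0 := by
  ext v
  exact norm_le_zero_iff.1 ((norm_tensorOp_le 0 S v).trans (by simp))

theorem inner_tensorOp [CompleteSpace H] [CompleteSpace K] (T : H →L[ℂ] H) (S : K →L[ℂ] K)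
    (v w : HTensor H K) :
    inner ℂ (tensorOp T S v) w = inner ℂ v (tensorOp T.adjoint S.adjoint w) := by
  induction v, w using UniformSpace.Completion.induction_on₂ with
  | hp => exact isClosed_eq (by fun_prop) (by fun_prop)
  | ih u u' =>
    simp only [tensorOp_coe, UniformSpace.Completion.inner_coe]
    induction u using TensorProduct.induction_on with
    | zero => simp
    | add a b ha hb => rw [map_add, inner_add_left, inner_add_left, ha, hb]
    | tmul a b =>
      induction u' using TensorProduct.induction_on with
      | zero => simp
      | add c d hc hd => rw [map_add, inner_add_right, inner_add_right, hc, hd]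
      | tmul c d => simp [ContinuousLinearMap.adjoint_inner_right]

end Tensor

/-! ### Strong quasi-locality -/

namespace XModule

variable {X : Type*} [MetricSpace X]
  {H : Type*} [NormedAddCommGroup H] [InnerProductSpace ℂ H] [CompleteSpace H]
  (M : XModule X H)
  {K : Type*} [NormedAddCommGroup K] [InnerProductSpace ℂ K] [CompleteSpace K]

theorem chi_adjoint (A : Set X) : (M.chi A).adjoint = M.chi A :=
  (isSelfAdjoint_starProjection _).adjoint_eq

theorem chi_comp_self (A : Set X) : M.chi A ∘L M.chi A = M.chi A :=
  (Submodule.isIdempotentElem_starProjection (M.subspace A))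

theorem chi_comp_of_disjoint {A B : Set X} (h : Disjoint A B) : M.chi A ∘L M.chi B = 0 := by
  refine Submodule.IsOrtho.starProjection_comp_starProjection ?_
  have key : M.subspace A ⟂ M.subspace B := by
    rw [Submodule.isOrtho_iff_le]
    refine Submodule.topologicalClosure_minimal _ ?_ (Submodule.isClosed_orthogonal _)
    rw [← Submodule.isOrtho_iff_le, Submodule.isOrtho_comm, Submodule.isOrtho_iff_le]
    refine Submodule.topologicalClosure_minimal _ ?_ (Submodule.isClosed_orthogonal _)
    rw [← Submodule.isOrtho_iff_le, Submodule.isOrtho_span]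
    rintro _ ⟨f, ξ, hf, rfl⟩ _ ⟨f', ξ', hf', rfl⟩
    have h0 : star f * f' = 0 := by
      ext x
      by_cases hx : x ∈ B
      · simp [hf' x (Set.disjoint_left.1 h.symm hx)]
      · simp [hf x hx]
    have h1 : M.rep (star f) ∘L M.rep f' = 0 := by
      have := map_mul M.rep (star f) f'
      rw [h0, map_zero] at this
      exact this.symm
    have h2 := congrArg (fun S : H →L[ℂ] H => inner ℂ ξ (S ξ')) h1
    simp only [map_star, ContinuousLinearMap.star_eq_adjoint, ContinuousLinearMap.comp_apply,
      ContinuousLinearMap.adjoint_inner_right, zero_apply,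
      inner_zero_right] at h2
    exact h2
  exact key

theorem inner_chi_tensor {x y : X} (hxy : x ≠ y) (S S' : K →L[ℂ] K) (v w : HTensor H K) :
    inner ℂ (tensorOp (M.chi {x}) S v) (tensorOp (M.chi {y}) S' w) = 0 := by
  rw [inner_tensorOp, tensorOp_comp, chi_adjoint,
    M.chi_comp_of_disjoint (Set.disjoint_singleton.2 hxy), tensorOp_zero_left]
  simp

/-- Bessel's inequality for the orthogonal projections `χ_{x} ⊗ Id`. -/
theorem sum_norm_sq_le (F : Finset X) (v : HTensor H K) :
    ∑ x ∈ F, ‖tensorOp (M.chi {x}) (ContinuousLinearMap.id ℂ K) v‖ ^ 2 ≤ ‖v‖ ^ 2 := by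
  classical
  set P : X → HTensor H K := fun x => tensorOp (M.chi {x}) (ContinuousLinearMap.id ℂ K) v with hP
  have h1 : ∀ x, inner ℂ (P x) v = inner ℂ (P x) (P x) := by
    intro x
    have : P x = tensorOp (M.chi {x}) (ContinuousLinearMap.id ℂ K) (P x) := by
      simp only [hP]
      rw [tensorOp_comp, chi_comp_self]
      rfl
    conv_lhs => rw [this, inner_tensorOp, chi_adjoint, ContinuousLinearMap.adjoint_id]
  have h2 : inner ℂ (∑ x ∈ F, P x) (∑ x ∈ F, P x) = inner ℂ (∑ x ∈ F, P x) v := by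
    rw [sum_inner, sum_inner]
    refine Finset.sum_congr rfl fun x hx => ?_
    rw [inner_sum, h1, Finset.sum_eq_single x]
    · intro y _ hyx
      exact M.inner_chi_tensor hyx.symm _ _ _ _
    · exact fun h => absurd hx h
  have h3 : ‖∑ x ∈ F, P x‖ ^ 2 = ∑ x ∈ F, ‖P x‖ ^ 2 := by
    have := congrArg Complex.re (h2.trans (sum_inner (𝕜 := ℂ) F P v))
    simp only [h1] at this
    simpa [inner_self_eq_norm_sq_to_K, ← Complex.ofReal_pow] using this
  have h4 : ‖∑ x ∈ F, P x‖ ^ 2 ≤ ‖∑ x ∈ F, P x‖ * ‖v‖ := by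
    have := norm_inner_le_norm (𝕜 := ℂ) (∑ x ∈ F, P x) v
    rw [← h2, inner_self_eq_norm_sq_to_K] at this
    simpa using this
  rw [← h3]
  nlinarith [norm_nonneg (∑ x ∈ F, P x), norm_nonneg v, sq_nonneg (‖∑ x ∈ F, P x‖ - ‖v‖)]

/-- The family `(χ_{x} ⊗ g(x)) v` is summable, with the sum bounded by `C ‖v‖`. -/
theorem lambda_aux (g : X → K →L[ℂ] K) {C : ℝ} (hC : ∀ x, ‖g x‖ ≤ C) (v : HTensor H K) :
    Summable (fun x => tensorOp (M.chi {x}) (g x) v) ∧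
      ‖∑' x, tensorOp (M.chi {x}) (g x) v‖ ≤ max C 0 * ‖v‖ := by
  classical
  set S : X → HTensor H K := fun x => tensorOp (M.chi {x}) (g x) v with hS
  have hbd : ∀ x, ‖S x‖ ^ 2 ≤
      max C 0 ^ 2 * ‖tensorOp (M.chi {x}) (ContinuousLinearMap.id ℂ K) v‖ ^ 2 := by
    intro x
    have h1 : S x = tensorOp (ContinuousLinearMap.id ℂ H) (g x)
        (tensorOp (M.chi {x}) (ContinuousLinearMap.id ℂ K) v) := by
      rw [tensorOp_comp]
      rfl
    rw [← mul_pow, h1]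
    refine pow_le_pow_left₀ (norm_nonneg _) ((norm_tensorOp_le _ _ _).trans ?_) 2
    refine mul_le_mul_of_nonneg_right ?_ (norm_nonneg _)
    calc ‖ContinuousLinearMap.id ℂ H‖ * ‖g x‖ ≤ 1 * ‖g x‖ :=
          mul_le_mul_of_nonneg_right ContinuousLinearMap.norm_id_le (norm_nonneg _)
      _ ≤ max C 0 := by rw [one_mul]; exact (hC x).trans (le_max_left _ _)
  have hfin : ∀ F : Finset X, ∑ x ∈ F, ‖S x‖ ^ 2 ≤ (max C 0 * ‖v‖) ^ 2 := by
    intro F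
    calc ∑ x ∈ F, ‖S x‖ ^ 2
        ≤ ∑ x ∈ F, max C 0 ^ 2 * ‖tensorOp (M.chi {x}) (ContinuousLinearMap.id ℂ K) v‖ ^ 2 :=
          Finset.sum_le_sum fun x _ => hbd x
      _ ≤ (max C 0 * ‖v‖) ^ 2 := by
          rw [← Finset.mul_sum, mul_pow]
          exact mul_le_mul_of_nonneg_left (M.sum_norm_sq_le F v) (sq_nonneg _)
  let V : X → Submodule ℂ (HTensor H K) := fun x => ℂ ∙ S x
  have hV : OrthogonalFamily ℂ (fun x => V x) fun x => (V x).subtypeₗᵢ := by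
    intro x y hxy a b
    obtain ⟨c, hc⟩ := Submodule.mem_span_singleton.1 a.2
    obtain ⟨d, hd⟩ := Submodule.mem_span_singleton.1 b.2
    change inner ℂ (a : HTensor H K) (b : HTensor H K) = 0
    rw [← hc, ← hd, inner_smul_left, inner_smul_right, M.inner_chi_tensor hxy]
    simp
  let s : ∀ x, V x := fun x => ⟨S x, Submodule.mem_span_singleton_self _⟩
  have hsum : Summable S :=
    (hV.summable_iff_norm_sq_summable s).2
      (summable_of_sum_le (fun x => sq_nonneg _) hfin)
  refine ⟨hsum, ?_⟩
  refine le_of_tendsto hsum.hasSum.norm (Filter.Eventually.of_forall fun F => ?_)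
  have h5 : ‖∑ x ∈ F, S x‖ ^ 2 = ∑ x ∈ F, ‖S x‖ ^ 2 := hV.norm_sum s F
  exact le_of_sq_le_sq (by rw [h5]; exact hfin F) (by positivity)

/-- The operator `Λ(g)` on `H ⊗ K` attached to a bounded operator valued map `g`: the
block-diagonal operator with `Id_{H_x} ⊗ g(x)` at the entry `(x, x)`, where `H_x = χ_{x} H`; that
is, the strongly convergent sum `∑_x χ_{x} ⊗ g(x)`. -/
def lambda (g : X → K →L[ℂ] K) (hg : ∃ C : ℝ, ∀ x, ‖g x‖ ≤ C) : HTensor H K →L[ℂ] HTensor H K :=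
  LinearMap.mkContinuous
    { toFun := fun v => ∑' x, tensorOp (M.chi {x}) (g x) v
      map_add' := fun v w => by
        obtain ⟨C, hC⟩ := hg
        simp only [map_add]
        exact (M.lambda_aux g hC v).1.tsum_add (M.lambda_aux g hC w).1
      map_smul' := fun c v => by
        obtain ⟨C, hC⟩ := hg
        simp only [map_smul, RingHom.id_apply]
        exact (M.lambda_aux g hC v).1.tsum_const_smul c }
    (max hg.choose 0)
    (fun v => (M.lambda_aux g hg.choose_spec v).2)

/-- Strong quasi-locality, through maps `g` into the closed unit ball of the compact operators on
the auxiliary Hilbert space `K`, and the commutators `[T ⊗ Id, Λ(g)]`. -/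
def IsStronglyQuasiLocal (K : Type*) [NormedAddCommGroup K] [InnerProductSpace ℂ K]
    [CompleteSpace K] (T : H →L[ℂ] H) : Prop :=
  ∀ ε : ℝ, 0 < ε → ∃ δ R : ℝ, 0 < δ ∧ 0 < R ∧
    ∀ (g : X → K →L[ℂ] K) (_ : ∀ x, IsCompactOperator (g x)) (hg : ∀ x, ‖g x‖ ≤ 1),
      HasVariation g δ R →
        ‖tensorOp T (ContinuousLinearMap.id ℂ K) ∘L M.lambda g ⟨1, hg⟩ -
          M.lambda g ⟨1, hg⟩ ∘L tensorOp T (ContinuousLinearMap.id ℂ K)‖ < ε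

/-- The strongly quasi-local algebra. -/
def stronglyQuasiLocal (K : Type*) [NormedAddCommGroup K] [InnerProductSpace ℂ K]
    [CompleteSpace K] : Set (H →L[ℂ] H) :=
  {T | M.IsLocallyCompact T ∧ M.IsStronglyQuasiLocal K T}

end XModule

end RoeQL

end

/-! Part 1 tests strong quasi-locality on g = f · p, where p is the projection onto a unit vector e
and f is a slowly varying Lipschitz function vanishing on B and equal to 1 on A. Cut down to A, B
and e, the commutator [T ⊗ Id, Λ(g)] becomes -χ_A T χ_B (`norm_chi_comp_le_commutator`).

Part 2: the commutator has norm at most 2‖T‖, so strong quasi-locality is a norm-closed condition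
and it suffices to treat finite propagation. The (x, y) block of the commutator is χ_x T χ_y ⊗ (g y
- g x), which is small when x and y are close and zero otherwise. Bounded geometry limits the number
of non-zero blocks per row and column, and Schur's test applies (`norm_le_of_norm_blocks_le`).

Part 3 needs quasi-local operators to lie in the Roe algebra. Property A yields unit vectors ξ x
that vary little at scale r and are orthogonal at large distance. With V v = ∑ χ_x v ⊗ ξ x, the
compression T' = V*(T ⊗ Id)V multiplies the (x, y) block of T by ⟪ξ x, ξ y⟫. Hence T' has finite
propagation, inherits local compactness and the off-diagonal bounds of T, and is close to T on every
r-ball.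

Local closeness becomes norm closeness by `norm_le_of_norm_ball_le`, which uses property A again:
most of the mass of a vector sits on bounded, mutually distant pieces (`PropertyA.exists_sparse`),
and on such vectors T - T' is almost block diagonal. There is no circularity: ε depends only on ‖T‖
and the target η, R on ε, r on R, and ξ is chosen last. -/

noncomputable section

namespace RoeQL

/-! ### Operators on Hilbert space tensor products -/

section Tensor

variable {H : Type*} [NormedAddCommGroup H] [InnerProductSpace ℂ H]
  {K : Type*} [NormedAddCommGroup K] [InnerProductSpace ℂ K]

/-- The operator `v ↦ v ⊗ k`. -/
def tens (k : K) : H →L[ℂ] HTensor H K :=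
  UniformSpace.Completion.toComplL ∘L (TensorProduct.mkL ℂ H K).flip k

theorem tens_apply (k : K) (v : H) : tens k v = ((v ⊗ₜ[ℂ] k : H ⊗[ℂ] K) : HTensor H K) := rfl

theorem norm_tens (k : K) (v : H) : ‖tens k v‖ = ‖v‖ * ‖k‖ := by
  rw [tens_apply, UniformSpace.Completion.norm_coe, TensorProduct.norm_tmul]

theorem norm_tens_le (k : K) : ‖(tens k : H →L[ℂ] HTensor H K)‖ ≤ ‖k‖ :=
  ContinuousLinearMap.opNorm_le_bound _ (norm_nonneg _) fun v => by rw [norm_tens, mul_comm]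

theorem inner_tens (k l : K) (v w : H) :
    inner ℂ (tens k v) (tens l w) = inner ℂ v w * inner ℂ k l := by
  rw [tens_apply, tens_apply, UniformSpace.Completion.inner_coe, TensorProduct.inner_tmul]

theorem tens_sub (k l : K) (v : H) : tens (k - l) v = tens k v - tens l v := by
  rw [tens_apply, TensorProduct.tmul_sub, UniformSpace.Completion.coe_sub]
  rfl

theorem tens_zero (v : H) : tens (0 : K) v = 0 := by
  rw [tens_apply, TensorProduct.tmul_zero, UniformSpace.Completion.coe_zero]

theorem tensorOp_tens (T : H →L[ℂ] H) (S : K →L[ℂ] K) (k : K) (v : H) :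
    tensorOp T S (tens k v) = tens (S k) (T v) := by
  rw [tens_apply, tensorOp_coe, TensorProduct.mapL_tmul, tens_apply]

theorem hTensor_ext {E : Type*} [NormedAddCommGroup E] [NormedSpace ℂ E]
    {f g : HTensor H K →L[ℂ] E} (h : ∀ k v, f (tens k v) = g (tens k v)) : f = g := by
  ext v
  induction v using UniformSpace.Completion.induction_on with
  | hp => exact isClosed_eq (by fun_prop) (by fun_prop)
  | ih u =>
    induction u using TensorProduct.induction_on with
    | zero => rw [UniformSpace.Completion.coe_zero, map_zero, map_zero]
    | add a b ha hb => rw [UniformSpace.Completion.coe_add, map_add, map_add, ha, hb]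
    | tmul a b => exact h b a

theorem tensorOp_comp_eq (T T' : H →L[ℂ] H) (S S' : K →L[ℂ] K) :
    tensorOp T S ∘L tensorOp T' S' = tensorOp (T ∘L T') (S ∘L S') := by
  ext v
  exact tensorOp_comp T T' S S' v

theorem tensorOp_sub_left (T T' : H →L[ℂ] H) (S : K →L[ℂ] K) :
    tensorOp (T - T') S = tensorOp T S - tensorOp T' S :=
  hTensor_ext fun k v => by simp [tensorOp_tens]

theorem tensorOp_sub_right (T : H →L[ℂ] H) (S S' : K →L[ℂ] K) :
    tensorOp T (S - S') = tensorOp T S - tensorOp T S' :=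
  hTensor_ext fun k v => by
    rw [sub_apply, tensorOp_tens, tensorOp_tens, tensorOp_tens,
      sub_apply, tens_sub]

theorem tensorOp_zero_right (T : H →L[ℂ] H) : tensorOp T (0 : K →L[ℂ] K) = 0 :=
  hTensor_ext fun k v => by rw [tensorOp_tens]; simp [tens_zero]

theorem tensorOp_id : tensorOp (.id ℂ H) (.id ℂ K) = .id ℂ (HTensor H K) :=
  hTensor_ext fun k v => by simp [tensorOp_tens]

theorem opNorm_tensorOp_le (T : H →L[ℂ] H) (S : K →L[ℂ] K) : ‖tensorOp T S‖ ≤ ‖T‖ * ‖S‖ :=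
  ContinuousLinearMap.opNorm_le_bound _ (by positivity) (norm_tensorOp_le T S)

theorem opNorm_tensorOp_id_le (T : H →L[ℂ] H) : ‖tensorOp T (.id ℂ K)‖ ≤ ‖T‖ :=
  (opNorm_tensorOp_le _ _).trans
    (mul_le_of_le_one_right (norm_nonneg _) ContinuousLinearMap.norm_id_le)

theorem tensorOp_adjoint [CompleteSpace H] [CompleteSpace K] (T : H →L[ℂ] H) (S : K →L[ℂ] K) :
    (tensorOp T S).adjoint = tensorOp T.adjoint S.adjoint := by
  symm
  rw [ContinuousLinearMap.eq_adjoint_iff]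
  intro v w
  rw [inner_tensorOp]
  simp

end Tensor

/-! ### The projections of a module over a discrete space -/

namespace XModule

variable {X : Type*} [MetricSpace X]
  {H : Type*} [NormedAddCommGroup H] [InnerProductSpace ℂ H] [CompleteSpace H]
  (M : XModule X H)

theorem subspace_mono {A B : Set X} (h : A ⊆ B) : M.subspace A ≤ M.subspace B := by
  refine Submodule.topologicalClosure_mono (Submodule.span_mono ?_)
  rintro _ ⟨f, ξ, hf, rfl⟩
  exact ⟨f, ξ, fun x hx => hf x fun h' => hx (h h'), rfl⟩

theorem chi_comp_of_subset_left {A B : Set X} (h : A ⊆ B) : M.chi A ∘L M.chi B = M.chi A :=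
  Submodule.starProjection_comp_starProjection_of_le (M.subspace_mono h)

theorem chi_comp_of_subset_right {A B : Set X} (h : A ⊆ B) : M.chi B ∘L M.chi A = M.chi A := by
  have := congrArg ContinuousLinearMap.adjoint (M.chi_comp_of_subset_left h)
  rwa [ContinuousLinearMap.adjoint_comp, chi_adjoint, chi_adjoint] at this

theorem norm_chi_le (A : Set X) : ‖M.chi A‖ ≤ 1 := Submodule.starProjection_norm_le _

theorem norm_chi_apply_le (A : Set X) (v : H) : ‖M.chi A v‖ ≤ ‖v‖ := by
  simpa using (M.chi A).le_of_opNorm_le (M.norm_chi_le A) v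

theorem chi_comp_singleton (A : Set X) [DecidablePred (· ∈ A)] (x : X) :
    M.chi A ∘L M.chi {x} = if x ∈ A then M.chi {x} else 0 := by
  split_ifs with h
  · exact M.chi_comp_of_subset_right (Set.singleton_subset_iff.2 h)
  · exact M.chi_comp_of_disjoint (Set.disjoint_singleton_right.2 h)

theorem rep_continuous : Continuous M.rep :=
  AddMonoidHomClass.continuous_of_bound M.rep 1 fun f => by
    rw [one_mul]
    exact NonUnitalStarAlgHom.norm_apply_le M.rep f

theorem isClosed_isLocallyCompact : IsClosed {T | M.IsLocallyCompact T} := by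
  have : {T | M.IsLocallyCompact T} =
      ⋂ f, {T : H →L[ℂ] H | IsCompactOperator (M.rep f ∘L T)} ∩
        {T : H →L[ℂ] H | IsCompactOperator (T ∘L M.rep f)} := by
    ext T
    simp [IsLocallyCompact]
  rw [this]
  refine isClosed_iInter fun f => IsClosed.inter ?_ ?_
  · exact isClosed_setOfPred_isCompactOperator.preimage
      (f := fun T : H →L[ℂ] H => M.rep f ∘L T) (by fun_prop)
  · exact isClosed_setOfPred_isCompactOperator.preimage
      (f := fun T : H →L[ℂ] H => T ∘L M.rep f) (by fun_prop)

variable [DiscreteTopology X]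

/-- The indicator function of a finite set, as an element of `C₀(X)`. -/
def indic (F : Finset X) : C₀(X, ℂ) where
  toFun := Set.indicator (F : Set X) 1
  continuous_toFun := continuous_of_discreteTopology
  zero_at_infty' := by
    refine tendsto_const_nhds.congr' ?_
    filter_upwards [F.finite_toSet.isCompact.compl_mem_cocompact] with x hx
    exact (Set.indicator_of_notMem hx _).symm

theorem indic_apply (F : Finset X) (x : X) : indic F x = Set.indicator (F : Set X) 1 x := rfl

/-- Links the projection `chi` to the representation: 1_F f = f for every f vanishing off F, so v -
`M.rep (indic F) v` is orthogonal to the range of `M.chi F`. Additivity of `rep` then yields finite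
additivity of `chi`. -/
theorem rep_indic (F : Finset X) : M.rep (indic F) = M.chi F := by
  classical
  ext v
  symm
  refine Submodule.eq_starProjection_of_mem_of_inner_eq_zero ?_ ?_
  · refine Submodule.le_topologicalClosure _ (Submodule.subset_span ⟨indic F, v, ?_, rfl⟩)
    intro x hx
    rw [indic_apply, Set.indicator_of_notMem hx]
  · suffices h : M.subspace (F : Set X) ≤ (ℂ ∙ (v - M.rep (indic F) v))ᗮ by
      intro w hw
      exact Submodule.mem_orthogonal_singleton_iff_inner_right.1 (h hw)
    refine Submodule.topologicalClosure_minimal _ ?_ (Submodule.isClosed_orthogonal _)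
    rw [Submodule.span_le]
    rintro _ ⟨f, ξ, hf, rfl⟩
    rw [SetLike.mem_coe, Submodule.mem_orthogonal_singleton_iff_inner_right]
    have h1 : star (indic F) * f = f := by
      ext x
      by_cases hx : x ∈ (F : Set X)
      · simp [indic_apply, Set.indicator_of_mem hx]
      · simp [hf x hx]
    have h2 := congrArg M.rep h1
    rw [map_mul, map_star, ContinuousLinearMap.star_eq_adjoint] at h2
    rw [inner_sub_left, sub_eq_zero, ← ContinuousLinearMap.adjoint_inner_right]
    conv_lhs => rw [← h2]
    rfl

/-- Compact subsets of a discrete space are finite, so f is uniformly small off a finite set. -/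
theorem tendsto_mul_indic (f : C₀(X, ℂ)) :
    Filter.Tendsto (fun F : Finset X => indic F * f) Filter.atTop (nhds f) := by
  classical
  rw [Metric.tendsto_nhds]
  intro ε hε
  have h0 := f.zero_at_infty'
  rw [Filter.cocompact_eq_cofinite, Metric.tendsto_nhds] at h0
  have h1 := h0 (ε / 2) (half_pos hε)
  rw [Filter.eventually_cofinite] at h1
  filter_upwards [Filter.eventually_ge_atTop h1.toFinset] with F hF
  refine lt_of_le_of_lt ?_ (half_lt_self hε)
  rw [← ZeroAtInftyContinuousMap.dist_toBCF_eq_dist,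
    BoundedContinuousFunction.dist_le (by positivity)]
  intro x
  change dist (indic F x * f x) (f x) ≤ _
  by_cases hx : x ∈ F
  · rw [indic_apply, Set.indicator_of_mem (by exact hx)]
    simpa using (half_pos hε).le
  · rw [indic_apply, Set.indicator_of_notMem (by exact hx)]
    have : x ∉ h1.toFinset := fun h => hx (hF h)
    simp only [Set.Finite.mem_toFinset, Set.mem_ofPred_eq, not_not] at this
    rw [zero_mul, dist_comm]
    exact this.le

theorem chi_finset (F : Finset X) : M.chi F = ∑ x ∈ F, M.chi {x} := by
  classical
  have h : indic F = ∑ x ∈ F, indic {x} := by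
    ext y
    have h2 : (∑ x ∈ F, indic {x} : C₀(X, ℂ)) y = ∑ x ∈ F, indic {x} y :=
      map_sum ({ toFun := fun f => f y, map_zero' := rfl, map_add' := fun _ _ => rfl } :
        C₀(X, ℂ) →+ ℂ) _ F
    rw [h2]
    simp [indic_apply, Set.indicator_apply,]
  rw [← rep_indic, h, map_sum]
  refine Finset.sum_congr rfl fun x _ => ?_
  rw [rep_indic, Finset.coe_singleton]

/-- Non-degeneracy enters here: the ranges of the χ_F increase with F, and their union is dense
because it contains every `M.rep (indic F * f) ξ`. -/
theorem hasSum_chi (v : H) : HasSum (fun x => M.chi {x} v) v := by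
  classical
  have h1 : ∀ F : Finset X, ∑ x ∈ F, M.chi {x} v = (M.subspace (F : Set X)).starProjection v := by
    intro F
    have := congrArg (fun S : H →L[ℂ] H => S v) (M.chi_finset F)
    rw [sum_apply] at this
    exact this.symm
  rw [HasSum, SummationFilter.unconditional_filter]
  simp only [h1]
  refine Submodule.starProjection_tendsto_self _ ?_ v ?_
  · exact fun F G h => M.subspace_mono (Finset.coe_subset.2 h)
  · rw [← M.nondegenerate]
    refine Submodule.topologicalClosure_minimal _ ?_ (Submodule.isClosed_topologicalClosure _)
    rw [Submodule.span_le]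
    rintro _ ⟨f, ξ, rfl⟩
    have h2 : Filter.Tendsto (fun F : Finset X => M.rep (indic F * f) ξ) Filter.atTop
        (nhds (M.rep f ξ)) :=
      (((ContinuousLinearMap.apply ℂ H ξ).continuous.comp M.rep_continuous).tendsto f).comp
        (tendsto_mul_indic f)
    refine mem_closure_of_tendsto h2 (Filter.Eventually.of_forall fun F => ?_)
    refine Submodule.mem_iSup_of_mem F ?_
    refine Submodule.le_topologicalClosure _ (Submodule.subset_span ⟨_, ξ, ?_, rfl⟩)
    intro x hx
    change indic F x * f x = 0
    rw [indic_apply, Set.indicator_of_notMem hx, zero_mul]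

theorem ext_chi {E : Type*} [NormedAddCommGroup E] [NormedSpace ℂ E] {f g : H →L[ℂ] E}
    (h : ∀ x, f ∘L M.chi {x} = g ∘L M.chi {x}) : f = g := by
  ext v
  refine (f.hasSum (M.hasSum_chi v)).unique ?_
  have : (fun x => f (M.chi {x} v)) = fun x => g (M.chi {x} v) := by
    funext x
    exact congrArg (fun S : H →L[ℂ] E => S v) (h x)
  rw [this]
  exact g.hasSum (M.hasSum_chi v)

/-- Finite sums of point projections settle finitely supported f; the other f are limits of these,
and compactness survives norm limits. -/
theorem isLocallyCompact_iff (T : H →L[ℂ] H) :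
    M.IsLocallyCompact T ↔ ∀ x, IsCompactOperator (M.chi {x} ∘L T) ∧
      IsCompactOperator (T ∘L M.chi {x}) := by
  classical
  constructor
  · intro h x
    have := h (indic {x})
    rwa [rep_indic, Finset.coe_singleton] at this
  · intro h f
    have hF : ∀ F : Finset X, IsCompactOperator (M.chi F ∘L T) ∧
        IsCompactOperator (T ∘L M.chi F) := by
      intro F
      rw [chi_finset]
      induction F using Finset.induction_on with
      | empty =>
        constructor
        · simpa using (isCompactOperator_zero : IsCompactOperator (0 : H → H))
        · simpa using (isCompactOperator_zero : IsCompactOperator (0 : H → H))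
      | insert x F hx ih =>
        rw [Finset.sum_insert hx, ContinuousLinearMap.add_comp, ContinuousLinearMap.comp_add]
        exact ⟨(h x).1.add ih.1, (h x).2.add ih.2⟩
    have hlim : Filter.Tendsto (fun F : Finset X => M.rep (indic F * f)) Filter.atTop
        (nhds (M.rep f)) := (M.rep_continuous.tendsto f).comp (tendsto_mul_indic f)
    constructor
    · refine isCompactOperator_of_tendsto
        (((ContinuousLinearMap.compL ℂ H H H).flip T).continuous.tendsto _ |>.comp hlim)
        (Filter.Eventually.of_forall fun F => ?_)
      rw [Function.comp_apply, mul_comm, map_mul, rep_indic]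
      exact (hF F).1.clm_comp (M.rep f)
    · refine isCompactOperator_of_tendsto
        ((ContinuousLinearMap.compL ℂ H H H T).continuous.tendsto _ |>.comp hlim)
        (Filter.Eventually.of_forall fun F => ?_)
      rw [Function.comp_apply, map_mul, rep_indic]
      exact (hF F).2.comp_clm (M.rep f)

theorem mem_support_iff (T : H →L[ℂ] H) (x y : X) :
    (x, y) ∈ M.support T ↔ M.chi {x} ∘L T ∘L M.chi {y} ≠ 0 := by
  rw [support, Set.mem_ofPred_eq]
  constructor
  · intro h
    exact h {x} ((isOpen_discrete _).mem_nhds rfl) {y} ((isOpen_discrete _).mem_nhds rfl)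
  · intro h V hV U hU h0
    have h1 := M.chi_comp_of_subset_left (Set.singleton_subset_iff.2 (mem_of_mem_nhds hV))
    have h2 := M.chi_comp_of_subset_right (Set.singleton_subset_iff.2 (mem_of_mem_nhds hU))
    refine h ?_
    rw [← h1, ← h2, ContinuousLinearMap.comp_assoc, ← ContinuousLinearMap.comp_assoc T,
      ← ContinuousLinearMap.comp_assoc (M.chi V), h0, ContinuousLinearMap.zero_comp,
      ContinuousLinearMap.comp_zero]

end XModule

namespace XModule

/-! ### Block diagonal operators -/

variable {X : Type*} [MetricSpace X]
  {H : Type*} [NormedAddCommGroup H] [InnerProductSpace ℂ H] [CompleteSpace H]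
  (M : XModule X H)
  {K : Type*} [NormedAddCommGroup K] [InnerProductSpace ℂ K] [CompleteSpace K]

theorem hasSum_lambda (g : X → K →L[ℂ] K) (hg : ∃ C : ℝ, ∀ x, ‖g x‖ ≤ C) (v : HTensor H K) :
    HasSum (fun x => tensorOp (M.chi {x}) (g x) v) (M.lambda g hg v) := by
  obtain ⟨C, hC⟩ := id hg
  exact (M.lambda_aux g hC v).1.hasSum

theorem norm_lambda_le (g : X → K →L[ℂ] K) (hg : ∃ C : ℝ, ∀ x, ‖g x‖ ≤ C) {C : ℝ} (h0 : 0 ≤ C)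
    (hC : ∀ x, ‖g x‖ ≤ C) : ‖M.lambda g hg‖ ≤ C := by
  refine ContinuousLinearMap.opNorm_le_bound _ h0 fun v => ?_
  rw [← (M.hasSum_lambda g hg v).tsum_eq]
  simpa [max_eq_left h0] using (M.lambda_aux g hC v).2

theorem lambda_comp_chi_singleton (g : X → K →L[ℂ] K) (hg : ∃ C : ℝ, ∀ x, ‖g x‖ ≤ C) (x : X)
    (S : K →L[ℂ] K) :
    M.lambda g hg ∘L tensorOp (M.chi {x}) S = tensorOp (M.chi {x}) (g x ∘L S) := by
  ext v
  refine (M.hasSum_lambda g hg (tensorOp (M.chi {x}) S v)).unique ?_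
  have h := hasSum_single (f := fun y => tensorOp (M.chi {y}) (g y) (tensorOp (M.chi {x}) S v)) x
    (fun y hy => by
      rw [tensorOp_comp, M.chi_comp_of_disjoint (Set.disjoint_singleton.2 hy), tensorOp_zero_left,
        zero_apply])
  rwa [tensorOp_comp, chi_comp_self] at h

theorem chi_singleton_comp_lambda (g : X → K →L[ℂ] K) (hg : ∃ C : ℝ, ∀ x, ‖g x‖ ≤ C) (x : X)
    (S : K →L[ℂ] K) :
    tensorOp (M.chi {x}) S ∘L M.lambda g hg = tensorOp (M.chi {x}) (S ∘L g x) := by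
  ext v
  refine ((tensorOp (M.chi {x}) S).hasSum (M.hasSum_lambda g hg v)).unique ?_
  have h := hasSum_single (f := fun y => tensorOp (M.chi {x}) S (tensorOp (M.chi {y}) (g y) v)) x
    (fun y hy => by
      rw [tensorOp_comp, M.chi_comp_of_disjoint (Set.disjoint_singleton.2 hy.symm),
        tensorOp_zero_left, zero_apply])
  rwa [tensorOp_comp, chi_comp_self] at h

theorem sum_sq_norm_chi (F : Finset X) (v : HTensor H K) :
    ‖∑ x ∈ F, tensorOp (M.chi {x}) (.id ℂ K) v‖ ^ 2 =
      ∑ x ∈ F, ‖tensorOp (M.chi {x}) (.id ℂ K) v‖ ^ 2 := by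
  classical
  rw [← Complex.ofReal_inj]
  push_cast
  simp only [← Complex.coe_algebraMap]
  simp only [← inner_self_eq_norm_sq_to_K (𝕜 := ℂ)]
  rw [sum_inner]
  refine Finset.sum_congr rfl fun x hx => ?_
  rw [inner_sum, Finset.sum_eq_single x]
  · intro y _ hyx
    exact M.inner_chi_tensor hyx.symm _ _ _ _
  · exact fun h => absurd hx h

/-- As ‖Λ(g)‖ ≤ 1, replacing T by T' changes the commutator by at most 2‖T - T'‖ uniformly in g, so
δ and R found for a nearby T' also serve T. -/
theorem closure_isStronglyQuasiLocal_subset : closure {T | M.IsStronglyQuasiLocal K T} ⊆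
    {T | M.IsStronglyQuasiLocal K T} := by
  intro T hT ε hε
  obtain ⟨T', hT', hTT'⟩ := Metric.mem_closure_iff.1 hT (ε / 4) (by positivity)
  obtain ⟨δ, R, hδ, hR, h⟩ := hT' (ε / 2) (by positivity)
  refine ⟨δ, R, hδ, hR, fun g hgc hg hvar => ?_⟩
  have h1 := h g hgc hg hvar
  have hΛ : ‖M.lambda g ⟨1, hg⟩‖ ≤ 1 := M.norm_lambda_le g _ zero_le_one hg
  set Λ := M.lambda g ⟨1, hg⟩
  have h2 : tensorOp T (ContinuousLinearMap.id ℂ K) =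
      tensorOp T' (ContinuousLinearMap.id ℂ K) + tensorOp (T - T') (ContinuousLinearMap.id ℂ K) := by
    rw [tensorOp_sub_left]
    abel
  have h3 : ‖tensorOp (T - T') (ContinuousLinearMap.id ℂ K)‖ ≤ ε / 4 := by
    refine (opNorm_tensorOp_id_le _).trans ?_
    rw [← dist_eq_norm]
    exact hTT'.le
  set S := tensorOp (T - T') (ContinuousLinearMap.id ℂ K)
  set S' := tensorOp T' (ContinuousLinearMap.id ℂ K)
  have h4 : ‖S ∘L Λ‖ ≤ ε / 4 := by
    refine (ContinuousLinearMap.opNorm_comp_le _ _).trans ?_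
    nlinarith [norm_nonneg S, norm_nonneg Λ]
  have h5 : ‖Λ ∘L S‖ ≤ ε / 4 := by
    refine (ContinuousLinearMap.opNorm_comp_le _ _).trans ?_
    nlinarith [norm_nonneg S, norm_nonneg Λ]
  rw [h2, ContinuousLinearMap.add_comp, ContinuousLinearMap.comp_add]
  have h6 : S' ∘L Λ + S ∘L Λ - (Λ ∘L S' + Λ ∘L S) =
      (S' ∘L Λ - Λ ∘L S') + (S ∘L Λ - Λ ∘L S) := by abel
  rw [h6]
  have := norm_add_le (S' ∘L Λ - Λ ∘L S') (S ∘L Λ - Λ ∘L S)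
  have := norm_sub_le (S ∘L Λ) (Λ ∘L S)
  linarith

variable [DiscreteTopology X]

/-- For S = Id this says that the projections χ_x ⊗ Id sum strongly to the identity. -/
theorem lambda_const (S : K →L[ℂ] K) (hS : ∃ C : ℝ, ∀ _ : X, ‖S‖ ≤ C) :
    M.lambda (fun _ => S) hS = tensorOp (.id ℂ H) S := by
  refine hTensor_ext fun k v => (M.hasSum_lambda _ hS _).unique ?_
  simp only [tensorOp_tens]
  exact (tens (S k)).hasSum (M.hasSum_chi v)

theorem hasSum_tensorOp_chi (v : HTensor H K) :
    HasSum (fun x => tensorOp (M.chi {x}) (.id ℂ K) v) v := by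
  have h := M.hasSum_lambda (fun _ => .id ℂ K) ⟨_, fun _ => le_rfl⟩ v
  rwa [lambda_const, tensorOp_id] at h

theorem ext_tensorOp_chi {E : Type*} [NormedAddCommGroup E] [NormedSpace ℂ E]
    {f g : HTensor H K →L[ℂ] E}
    (h : ∀ x, f ∘L tensorOp (M.chi {x}) (.id ℂ K) = g ∘L tensorOp (M.chi {x}) (.id ℂ K)) :
    f = g := by
  ext v
  refine (f.hasSum (M.hasSum_tensorOp_chi v)).unique ?_
  have : (fun x => f (tensorOp (M.chi {x}) (.id ℂ K) v)) =
      fun x => g (tensorOp (M.chi {x}) (.id ℂ K) v) := by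
    funext x
    exact congrArg (fun S : HTensor H K →L[ℂ] E => S v) (h x)
  rw [this]
  exact g.hasSum (M.hasSum_tensorOp_chi v)

theorem lambda_comp_chi_of_eqOn (g : X → K →L[ℂ] K) (hg : ∃ C : ℝ, ∀ x, ‖g x‖ ≤ C) {A : Set X}
    {S : K →L[ℂ] K} (h : ∀ x ∈ A, g x = S) :
    M.lambda g hg ∘L tensorOp (M.chi A) (.id ℂ K) = tensorOp (M.chi A) S := by
  classical
  refine M.ext_tensorOp_chi fun x => ?_
  rw [ContinuousLinearMap.comp_assoc, tensorOp_comp_eq, tensorOp_comp_eq, chi_comp_singleton]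
  split_ifs with hx
  · rw [lambda_comp_chi_singleton, h x hx]
    rfl
  · rw [tensorOp_zero_left, tensorOp_zero_left, ContinuousLinearMap.comp_zero]

theorem chi_comp_lambda_of_eqOn (g : X → K →L[ℂ] K) (hg : ∃ C : ℝ, ∀ x, ‖g x‖ ≤ C) {A : Set X}
    {S : K →L[ℂ] K} (h : ∀ x ∈ A, g x = S) :
    tensorOp (M.chi A) (.id ℂ K) ∘L M.lambda g hg = tensorOp (M.chi A) S := by
  classical
  refine M.ext_tensorOp_chi fun x => ?_
  rw [ContinuousLinearMap.comp_assoc, lambda_comp_chi_singleton, tensorOp_comp_eq,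
    tensorOp_comp_eq, chi_comp_singleton]
  split_ifs with hx
  · rw [h x hx]
    rfl
  · rw [tensorOp_zero_left, tensorOp_zero_left]

/-! ### Strongly quasi-local operators are quasi-local -/

/-- Evaluate the commutator on χ_B v ⊗ e. The term applying Λ(g) first vanishes because g = 0 on B;
in the other, Λ(g) fixes e over A. What remains is -χ_A T χ_B v ⊗ e. -/
theorem norm_chi_comp_le_commutator {T : H →L[ℂ] H} (g : X → K →L[ℂ] K)
    (hg : ∃ C : ℝ, ∀ x, ‖g x‖ ≤ C) {e : K} (he : ‖e‖ = 1) {A B : Set X}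
    (hA : ∀ x ∈ A, g x = InnerProductSpace.rankOne ℂ e e) (hB : ∀ x ∈ B, g x = 0) :
    ‖M.chi A ∘L T ∘L M.chi B‖ ≤ ‖tensorOp T (ContinuousLinearMap.id ℂ K) ∘L M.lambda g hg -
      M.lambda g hg ∘L tensorOp T (ContinuousLinearMap.id ℂ K)‖ := by
  set D := tensorOp T (ContinuousLinearMap.id ℂ K) ∘L M.lambda g hg -
      M.lambda g hg ∘L tensorOp T (ContinuousLinearMap.id ℂ K) with hD
  refine ContinuousLinearMap.opNorm_le_bound _ (norm_nonneg D) fun v => ?_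
  have h1 : M.lambda g hg (tensorOp (M.chi B) (.id ℂ K) (tens e v)) = 0 := by
    rw [← ContinuousLinearMap.comp_apply, M.lambda_comp_chi_of_eqOn g hg hB, tensorOp_zero_right,
      zero_apply]
  have h2 : ∀ w, tensorOp (M.chi A) (.id ℂ K) (M.lambda g hg (tens e w)) = tens e (M.chi A w) := by
    intro w
    rw [← ContinuousLinearMap.comp_apply, M.chi_comp_lambda_of_eqOn g hg hA, tensorOp_tens]
    simp [he]
  have h3 : tensorOp (M.chi A) (.id ℂ K) (D (tens e (M.chi B v))) =
      - tens e (M.chi A (T (M.chi B v))) := by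
    rw [hD, sub_apply, ContinuousLinearMap.comp_apply, ContinuousLinearMap.comp_apply,
      tensorOp_tens, map_sub, ContinuousLinearMap.id_apply, h2]
    rw [tensorOp_tens, ContinuousLinearMap.id_apply] at h1
    rw [h1, map_zero, map_zero, zero_sub]
  have h4 : ‖M.chi A (T (M.chi B v))‖ =
      ‖tensorOp (M.chi A) (.id ℂ K) (D (tens e (M.chi B v)))‖ := by
    rw [h3, norm_neg, norm_tens, he, mul_one]
  rw [ContinuousLinearMap.comp_apply, ContinuousLinearMap.comp_apply, h4]
  calc _ ≤ ‖tensorOp (M.chi A) (.id ℂ K)‖ * ‖D (tens e (M.chi B v))‖ :=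
        ContinuousLinearMap.le_opNorm _ _
    _ ≤ 1 * ‖D (tens e (M.chi B v))‖ := by
        gcongr
        exact (opNorm_tensorOp_id_le _).trans (M.norm_chi_le A)
    _ ≤ ‖D‖ * ‖tens e (M.chi B v)‖ := by
        rw [one_mul]
        exact ContinuousLinearMap.le_opNorm _ _
    _ ≤ ‖D‖ * ‖v‖ := by
        rw [norm_tens, he, mul_one]
        gcongr
        exact M.norm_chi_apply_le B v

theorem isCompactOperator_rankOne {E F : Type*} [NormedAddCommGroup E] [NormedSpace ℂ E]
    [NormedAddCommGroup F] [InnerProductSpace ℂ F] (e : E) (f : F) :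
    IsCompactOperator (InnerProductSpace.rankOne ℂ e f) := by
  have h : IsCompactOperator (innerSL ℂ f : F →L[ℂ] ℂ) :=
    isCompactOperator_of_locallyCompactSpace_dom (innerSL ℂ f)
  exact h.clm_comp (ContinuousLinearMap.toSpanSingleton ℂ e)

theorem IsStronglyQuasiLocal.isQuasiLocal [Nontrivial K] {T : H →L[ℂ] H}
    (hT : M.IsStronglyQuasiLocal K T) : M.IsQuasiLocal T := by
  intro ε hε
  obtain ⟨δ, R, hδ, hR, h⟩ := hT ε hε
  -- A 1/L-Lipschitz function with L = 2R/δ varies by less than δ/2 over distances below R.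
  refine ⟨2 * R / δ, by positivity, fun A B hAB => ?_⟩
  -- `Metric.infDist x ∅ = 0`, so the cut-off f would not equal 1 on A when B is empty.
  rcases B.eq_empty_or_nonempty with rfl | hB
  · have : M.chi (∅ : Set X) = 0 := by
      simpa using M.chi_finset ∅
    simpa [this] using hε
  obtain ⟨e, he⟩ := exists_norm_eq K zero_le_one
  set L := 2 * R / δ with hL
  have hL0 : 0 < L := by positivity
  set f : X → ℝ := fun x => min 1 (Metric.infDist x B / L) with hf
  have hf0 : ∀ x, 0 ≤ f x := fun x => le_min zero_le_one (div_nonneg Metric.infDist_nonneg hL0.le)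
  have hf1 : ∀ x, f x ≤ 1 := fun x => min_le_left _ _
  have hfB : ∀ x ∈ B, f x = 0 := by
    intro x hx
    simp [hf, Metric.infDist_zero_of_mem hx]
  have hfA : ∀ x ∈ A, f x = 1 := by
    intro x hx
    refine min_eq_left ((one_le_div hL0).2 ?_)
    exact (Metric.le_infDist hB).2 fun y hy => hAB x hx y hy
  have hfl : ∀ x y, |f x - f y| ≤ dist x y / L := by
    intro x y
    refine (abs_min_sub_min_le_max _ _ _ _).trans (max_le (by simp; positivity) ?_)
    rw [← sub_div, abs_div, abs_of_pos hL0]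
    gcongr
    rw [abs_sub_le_iff]
    constructor
    · linarith [Metric.infDist_le_infDist_add_dist (s := B) (x := x) (y := y)]
    · linarith [Metric.infDist_le_infDist_add_dist (s := B) (x := y) (y := x), dist_comm x y]
  have hp : ‖InnerProductSpace.rankOne ℂ e e‖ = 1 := by
    rw [InnerProductSpace.norm_rankOne, he, one_mul]
  refine (M.norm_chi_comp_le_commutator (fun x => (f x : ℂ) • InnerProductSpace.rankOne ℂ e e)
    ⟨1, fun x => ?_⟩ he (fun x hx => ?_) (fun x hx => ?_)).trans_lt
    (h _ (fun x => ?_) (fun x => ?_) (fun x y hxy => ?_))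
  · rw [norm_smul, hp, mul_one, Complex.norm_real, Real.norm_of_nonneg (hf0 x)]
    exact hf1 x
  · simp only [hfA x hx, Complex.ofReal_one, one_smul]
  · simp only [hfB x hx, Complex.ofReal_zero, zero_smul]
  · exact (isCompactOperator_rankOne e e).smul _
  · rw [norm_smul, hp, mul_one, Complex.norm_real, Real.norm_of_nonneg (hf0 x)]
    exact hf1 x
  · rw [dist_eq_norm, ← sub_smul, norm_smul, hp, mul_one, ← Complex.ofReal_sub, Complex.norm_real,
      Real.norm_eq_abs]
    refine (hfl x y).trans_lt ?_
    rw [div_lt_iff₀ hL0, hL, mul_div_cancel₀ _ hδ.ne']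
    linarith

/-! ### The Roe algebra is strongly quasi-local -/

/-- Schur's test for operators of finite propagation on a space of bounded geometry. -/
theorem norm_le_of_norm_blocks_le (D : HTensor H K →L[ℂ] HTensor H K) {c R : ℝ} {N : ℕ}
    (hc : 0 ≤ c) (hN : ∀ x : X, (Metric.ball x R).encard ≤ N)
    (hD : ∀ x y v, ‖tensorOp (M.chi {x}) (.id ℂ K) (D (tensorOp (M.chi {y}) (.id ℂ K) v))‖ ≤
      c * ‖tensorOp (M.chi {y}) (.id ℂ K) v‖)
    (hR : ∀ x y v, R ≤ dist x y →
      tensorOp (M.chi {x}) (.id ℂ K) (D (tensorOp (M.chi {y}) (.id ℂ K) v)) = 0) :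
    ‖D‖ ≤ N * c := by
  classical
  have hfin : ∀ x : X, (Metric.ball x R).Finite := fun x =>
    Set.finite_of_encard_le_coe (hN x)
  let b : X → Finset X := fun x => (hfin x).toFinset
  have hb : ∀ x y, y ∈ b x ↔ dist x y < R := by
    intro x y
    simp [b, dist_comm]
  have hcard : ∀ x, (b x).card ≤ N := by
    intro x
    have := hN x
    rw [(hfin x).encard_eq_coe_toFinset_card] at this
    exact_mod_cast this
  refine ContinuousLinearMap.opNorm_le_bound _ (by positivity) fun v => ?_
  set P : X → HTensor H K → HTensor H K := fun x u => tensorOp (M.chi {x}) (.id ℂ K) u with hP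
  -- Only the points y of the R-ball contribute to row x; Cauchy–Schwarz over at most N terms costs
  -- the first factor N.
  have hrow : ∀ x, ‖P x (D v)‖ ^ 2 ≤ N * c ^ 2 * ∑ y ∈ b x, ‖P y v‖ ^ 2 := by
    intro x
    have h1 : P x (D v) = ∑ y ∈ b x, P x (D (P y v)) := by
      refine ((tensorOp (M.chi {x}) (.id ℂ K)).hasSum
        (D.hasSum (M.hasSum_tensorOp_chi v))).unique ?_
      refine hasSum_sum_of_ne_finset_zero fun y hy => ?_
      rw [hb, not_lt] at hy
      exact hR x y v hy
    have h2 : ‖P x (D v)‖ ≤ ∑ y ∈ b x, c * ‖P y v‖ := by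
      rw [h1]
      exact (norm_sum_le _ _).trans (Finset.sum_le_sum fun y _ => hD x y v)
    calc ‖P x (D v)‖ ^ 2 ≤ (∑ y ∈ b x, c * ‖P y v‖) ^ 2 := by gcongr
      _ ≤ (b x).card * ∑ y ∈ b x, (c * ‖P y v‖) ^ 2 := sq_sum_le_card_mul_sum_sq
      _ ≤ N * ∑ y ∈ b x, (c * ‖P y v‖) ^ 2 := by
          gcongr
          exact hcard x
      _ = _ := by
          simp only [mul_pow, ← Finset.mul_sum]
          ring
  have hF : ∀ F : Finset X, ‖∑ x ∈ F, P x (D v)‖ ≤ N * c * ‖v‖ := by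
    intro F
    refine le_of_sq_le_sq ?_ (by positivity)
    rw [hP, M.sum_sq_norm_chi F (D v)]
    calc ∑ x ∈ F, ‖P x (D v)‖ ^ 2 ≤ ∑ x ∈ F, N * c ^ 2 * ∑ y ∈ b x, ‖P y v‖ ^ 2 :=
          Finset.sum_le_sum fun x _ => hrow x
      _ = N * c ^ 2 * ∑ x ∈ F, ∑ y ∈ b x, ‖P y v‖ ^ 2 := by rw [Finset.mul_sum]
      -- After exchanging the sums, each y is counted for at most N points x, which costs the second
      -- factor N.
      _ = N * c ^ 2 * ∑ y ∈ F.biUnion b, ∑ x ∈ F with dist x y < R, ‖P y v‖ ^ 2 := by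
          congr 1
          refine Finset.sum_comm' fun x y => ?_
          simp only [hb, Finset.mem_filter, Finset.mem_biUnion]
          exact ⟨fun h => ⟨h, x, h⟩, fun h => h.1⟩
      _ ≤ N * c ^ 2 * ∑ y ∈ F.biUnion b, N * ‖P y v‖ ^ 2 := by
          gcongr with y _
          rw [Finset.sum_const, nsmul_eq_mul]
          gcongr
          refine le_trans ?_ (hcard y)
          gcongr
          intro x hx
          rw [hb, dist_comm]
          exact (Finset.mem_filter.1 hx).2
      _ ≤ N * c ^ 2 * (N * ‖v‖ ^ 2) := by
          rw [← Finset.mul_sum]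
          gcongr
          exact M.sum_norm_sq_le _ v
      _ = _ := by ring
  exact le_of_tendsto (M.hasSum_tensorOp_chi (D v)).norm (Filter.Eventually.of_forall hF)

theorem isStronglyQuasiLocal_of_propagation_lt_top (hX : BoundedGeometry X) {T : H →L[ℂ] H}
    (hT : M.propagation T < ⊤) : M.IsStronglyQuasiLocal K T := by
  intro ε hε
  -- The added 1 makes R exceed the propagation strictly, so blocks at distance R or more vanish.
  set R := (M.propagation T).toReal + 1 with hR
  have hR0 : 0 < R := by positivity
  obtain ⟨N, hN⟩ := hX R hR0
  set δ := ε / (2 * (N * ‖T‖ + 1)) with hδ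
  have hδ0 : 0 < δ := by positivity
  refine ⟨δ, R, hδ0, hR0, fun g _ hg hvar => ?_⟩
  have hzero : ∀ x y, R ≤ dist x y → M.chi {x} ∘L T ∘L M.chi {y} = 0 := by
    intro x y hxy
    by_contra h
    have h1 : edist x y ≤ M.propagation T := le_iSup₂_of_le (x, y) ((M.mem_support_iff T x y).2 h)
      le_rfl
    have h2 : dist x y ≤ (M.propagation T).toReal := by
      rw [dist_edist]
      exact ENNReal.toReal_mono hT.ne h1
    linarith
  have hblock : ∀ x y v, tensorOp (M.chi {x}) (.id ℂ K)
      ((tensorOp T (ContinuousLinearMap.id ℂ K) ∘L M.lambda g ⟨1, hg⟩ -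
          M.lambda g ⟨1, hg⟩ ∘L tensorOp T (ContinuousLinearMap.id ℂ K))
        (tensorOp (M.chi {y}) (.id ℂ K) v)) =
      tensorOp (M.chi {x} ∘L T ∘L M.chi {y}) (g y - g x) v := by
    intro x y v
    have h1 := congrArg (fun S : HTensor H K →L[ℂ] HTensor H K => S v)
      (M.lambda_comp_chi_singleton g ⟨1, hg⟩ y (.id ℂ K))
    have h2 : ∀ w, _ := fun w => congrArg (fun S : HTensor H K →L[ℂ] HTensor H K => S w)
      (M.chi_singleton_comp_lambda g ⟨1, hg⟩ x (.id ℂ K))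
    simp only [ContinuousLinearMap.comp_apply] at h1 h2
    rw [sub_apply, ContinuousLinearMap.comp_apply, ContinuousLinearMap.comp_apply, map_sub, h1, h2,
      tensorOp_comp, tensorOp_comp, tensorOp_comp, tensorOp_comp, tensorOp_sub_right, sub_apply]
    rfl
  have key := M.norm_le_of_norm_blocks_le (R := R) (c := ‖T‖ * δ)
    (tensorOp T (ContinuousLinearMap.id ℂ K) ∘L M.lambda g ⟨1, hg⟩ -
      M.lambda g ⟨1, hg⟩ ∘L tensorOp T (ContinuousLinearMap.id ℂ K)) (by positivity) hN ?_ ?_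
  · refine key.trans_lt ?_
    rw [hδ, ← mul_assoc, mul_div_assoc', div_lt_iff₀ (by positivity)]
    nlinarith [mul_nonneg (Nat.cast_nonneg (α := ℝ) N) (norm_nonneg T)]
  · intro x y v
    rcases lt_or_ge (dist x y) R with hxy | hxy
    -- Idempotence of χ_y makes the bound depend on χ_y v alone, as Schur's test requires.
    · have h3 : tensorOp (M.chi {y}) (.id ℂ K) v =
          tensorOp (M.chi {y}) (.id ℂ K) (tensorOp (M.chi {y}) (.id ℂ K) v) := by
        rw [tensorOp_comp, chi_comp_self]
        rfl
      rw [h3, hblock, ← h3]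
      refine (norm_tensorOp_le _ _ _).trans ?_
      gcongr
      · calc ‖M.chi {x} ∘L T ∘L M.chi {y}‖ ≤ ‖M.chi {x}‖ * (‖T‖ * ‖M.chi {y}‖) :=
              (ContinuousLinearMap.opNorm_comp_le _ _).trans
                (by gcongr; exact ContinuousLinearMap.opNorm_comp_le _ _)
          _ ≤ 1 * (‖T‖ * 1) := by
              gcongr <;> exact M.norm_chi_le _
          _ = ‖T‖ := by ring
      · rw [← dist_eq_norm, dist_comm]
        exact (hvar x y hxy).le
    · rw [hblock, hzero x y hxy, tensorOp_zero_left, zero_apply, norm_zero]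
      positivity
  · intro x y v hxy
    rw [hblock, hzero x y hxy, tensorOp_zero_left, zero_apply]

theorem roe_subset_stronglyQuasiLocal (hX : BoundedGeometry X) :
    M.roe ⊆ M.stronglyQuasiLocal K := by
  intro T hT
  constructor
  · exact M.isClosed_isLocallyCompact.closure_subset (closure_mono (fun S hS => hS.1) hT)
  · exact M.closure_isStronglyQuasiLocal_subset
      (closure_mono (fun S hS => M.isStronglyQuasiLocal_of_propagation_lt_top hX hS.2) hT)

theorem stronglyQuasiLocal_subset_quasiLocal [Nontrivial K] :
    M.stronglyQuasiLocal K ⊆ M.quasiLocal :=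
  fun _ hT => ⟨hT.1, hT.2.isQuasiLocal⟩

end XModule

/-! ### Metric sparsification -/

section Sparsification

variable {X : Type*} [MetricSpace X]

open Classical in
/-- Property A provides, for every weight, sets of bounded diameter with relatively small
boundary. -/
theorem PropertyA.exists_small_boundary (hX : BoundedGeometry X) (hA : PropertyA X) {R κ : ℝ}
    (hR : 0 < R) (hκ : 0 < κ) :
    ∃ S : ℝ, 0 < S ∧ ∀ μ : X → ℝ, (∀ x, 0 ≤ μ x) → ∀ F : Finset X, F.Nonempty →
      ∃ E ⊆ F, E.Nonempty ∧ (∀ x ∈ E, ∀ y ∈ E, dist x y ≤ S) ∧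
        ∑ x ∈ F with x ∉ E ∧ ∃ y ∈ E, dist x y < R, μ x ≤ κ * ∑ x ∈ E, μ x := by
  obtain ⟨N, hN⟩ := hX R hR
  -- The union bound below runs over at most N neighbours; N + 1 keeps the divisor positive.
  obtain ⟨A, hfin, hmem, hsd, S, hS, hdiam⟩ := hA R (κ / (N + 1)) hR (by positivity)
  refine ⟨2 * S, by positivity, fun μ hμ F hF => ?_⟩
  obtain ⟨a, rfl⟩ : ∃ a : X → Finset (X × ℕ), A = fun x => (a x : Set (X × ℕ)) :=
    ⟨fun x => (hfin x).toFinset, by simp⟩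
  simp only [Finset.mem_coe] at hmem hdiam
  have hsd' : ∀ x y, dist x y ≤ R → ((a y \ a x).card : ℝ) ≤ κ / (N + 1) * (a x).card := by
    intro x y hxy
    have h := hsd x y hxy
    rw [← Finset.coe_symmDiff, ← Finset.coe_inter, Set.ncard_coe_finset,
      Set.ncard_coe_finset] at h
    calc ((a y \ a x).card : ℝ) ≤ (symmDiff (a x) (a y)).card := by
          gcongr
          exact le_sup_right
      _ ≤ κ / (N + 1) * (a x ∩ a y).card := h.le
      _ ≤ _ := by
          gcongr
          exact Finset.inter_subset_left
  -- Averaging over p: if every R-boundary B p outweighed κ times E p, summing over p would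
  -- contradict the count of pairs (x, p) weighted by μ x.
  let P : Finset (X × ℕ) := F.biUnion a
  let E : X × ℕ → Finset X := fun p => F.filter fun x => p ∈ a x
  let B : X × ℕ → Finset X := fun p => F.filter fun x => x ∉ E p ∧ ∃ y ∈ E p, dist x y < R
  suffices h : ∃ p ∈ P, ∑ x ∈ B p, μ x ≤ κ * ∑ x ∈ E p, μ x by
    obtain ⟨p, hp, h⟩ := h
    obtain ⟨x, hx, hpx⟩ := Finset.mem_biUnion.1 hp
    refine ⟨E p, Finset.filter_subset _ _, ⟨x, Finset.mem_filter.2 ⟨hx, hpx⟩⟩, ?_, h⟩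
    -- As (y, 1) and p both lie in a y, every y in E p is within S of p.1; hence the diameter bound
    -- 2S.
    intro y hy z hz
    have h1 := hdiam y p (Finset.mem_filter.1 hy).2 (y, 1) (hmem y)
    have h2 := hdiam z p (Finset.mem_filter.1 hz).2 (z, 1) (hmem z)
    have h3 := dist_triangle_left y z p.1
    simp only at h1 h2
    linarith
  by_contra! hcon
  have hP : P.Nonempty := by
    obtain ⟨x, hx⟩ := hF
    exact ⟨(x, 1), Finset.mem_biUnion.2 ⟨x, hx, hmem x⟩⟩
  refine absurd (Finset.sum_lt_sum_of_nonempty hP hcon) (not_lt.2 ?_)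
  have hE : ∑ p ∈ P, κ * ∑ x ∈ E p, μ x = ∑ x ∈ F, κ * ((a x).card * μ x) := by
    simp only [← Finset.mul_sum]
    congr 1
    rw [Finset.sum_comm' (t' := F) (s' := a)]
    · simp
    · intro p x
      simp only [P, E, Finset.mem_filter, Finset.mem_biUnion]
      exact ⟨fun h => ⟨h.2.2, h.2.1⟩, fun h => ⟨⟨x, h.2, h.1⟩, h.2, h.1⟩⟩
  have hB : ∑ p ∈ P, ∑ x ∈ B p, μ x =
      ∑ x ∈ F, ((P.filter fun p => x ∈ B p).card : ℝ) * μ x := by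
    rw [Finset.sum_comm' (t' := F) (s' := fun x => P.filter fun p => x ∈ B p)]
    · simp
    · intro p x
      simp only [Finset.mem_filter]
      exact ⟨fun h => ⟨h, (Finset.mem_filter.1 h.2).1⟩, fun h => h.1⟩
  rw [hE, hB]
  refine Finset.sum_le_sum fun x _ => ?_
  rw [← mul_assoc]
  refine mul_le_mul_of_nonneg_right ?_ (hμ x)
  -- If x is in the boundary of E p, then p lies in a y but not in a x for some y within R of x.
  have hsub : (P.filter fun p => x ∈ B p) ⊆
      (F.filter fun y => dist x y < R).biUnion fun y => a y \ a x := by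
    intro p hp
    obtain ⟨-, hp⟩ := Finset.mem_filter.1 hp
    obtain ⟨hxF, hx, y, hy, hxy⟩ := Finset.mem_filter.1 hp
    obtain ⟨hyF, hy⟩ := Finset.mem_filter.1 hy
    refine Finset.mem_biUnion.2 ⟨y, Finset.mem_filter.2 ⟨hyF, hxy⟩, Finset.mem_sdiff.2 ⟨hy, ?_⟩⟩
    exact fun h => hx (Finset.mem_filter.2 ⟨hxF, h⟩)
  have hcard : (F.filter fun y => dist x y < R).card ≤ N := by
    have h : (((F.filter fun y => dist x y < R) : Finset X) : Set X).encard ≤ N := by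
      refine le_trans (Set.encard_le_encard fun y hy => ?_) (hN x)
      rw [Metric.mem_ball, dist_comm]
      exact (Finset.mem_filter.1 hy).2
    rw [Set.encard_coe_eq_coe_finsetCard] at h
    exact_mod_cast h
  calc ((P.filter fun p => x ∈ B p).card : ℝ)
      ≤ ((F.filter fun y => dist x y < R).biUnion fun y => a y \ a x).card := by gcongr
    _ ≤ ∑ y ∈ F with dist x y < R, ((a y \ a x).card : ℝ) := by
        exact_mod_cast Finset.card_biUnion_le
    _ ≤ ∑ y ∈ F with dist x y < R, κ / (N + 1) * (a x).card :=
        Finset.sum_le_sum fun y hy => hsd' x y (Finset.mem_filter.1 hy).2.le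
    _ = (F.filter fun y => dist x y < R).card * (κ / (N + 1) * (a x).card) := by
        rw [Finset.sum_const, nsmul_eq_mul]
    _ ≤ (N + 1) * (κ / (N + 1) * (a x).card) := by
        gcongr
        exact_mod_cast hcard.trans (Nat.le_succ N)
    _ = κ * (a x).card := by field_simp

/-- The metric sparsification property: up to a small proportion of the mass, every finite weight
lives on a union of uniformly bounded sets which are far away from each other. -/
theorem PropertyA.exists_sparse (hX : BoundedGeometry X) (hA : PropertyA X) {R κ : ℝ}
    (hR : 0 < R) (hκ : 0 < κ) :
    ∃ S : ℝ, 0 < S ∧ ∀ μ : X → ℝ, (∀ x, 0 ≤ μ x) → ∀ F : Finset X,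
      ∃ Ω ⊆ F, ∃ c : X → ℕ, (∀ x ∈ Ω, ∀ y ∈ Ω, c x = c y → dist x y ≤ S) ∧
        (∀ x ∈ Ω, ∀ y ∈ Ω, c x ≠ c y → R ≤ dist x y) ∧
        ∑ x ∈ F, μ x ≤ (1 + κ) * ∑ x ∈ Ω, μ x := by
  classical
  obtain ⟨S, hS, h⟩ := hA.exists_small_boundary hX hR hκ
  refine ⟨S, hS, fun μ hμ F => ?_⟩
  induction F using Finset.strongInduction with
  | H F ih =>
    rcases F.eq_empty_or_nonempty with rfl | hF
    · exact ⟨∅, subset_rfl, fun _ => 0, by simp⟩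
    -- Greedy removal: keep E, discard its boundary B of mass at most κ μ(E), and recurse on the
    -- rest, which is at distance at least R from E.
    obtain ⟨E, hEF, hE, hdiam, hsum⟩ := h μ hμ F hF
    set B : Finset X := F.filter fun x => x ∉ E ∧ ∃ y ∈ E, dist x y < R with hB
    have hEB : Disjoint E B := Finset.disjoint_left.2 fun x hx hx' =>
      (Finset.mem_filter.1 hx').2.1 hx
    have hEBF : E ∪ B ⊆ F := Finset.union_subset hEF (Finset.filter_subset _ _)
    obtain ⟨Ω, hΩ, c, hc1, hc2, hc3⟩ := ih (F \ (E ∪ B))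
      (Finset.sdiff_ssubset hEBF (hE.mono Finset.subset_union_left))
    have hΩF : ∀ x ∈ Ω, x ∈ F ∧ x ∉ E ∧ x ∉ B := by
      intro x hx
      have := hΩ hx
      rw [Finset.mem_sdiff, Finset.mem_union, not_or] at this
      exact this
    have hfar : ∀ x ∈ Ω, ∀ y ∈ E, R ≤ dist x y := by
      intro x hx y hy
      obtain ⟨h1, h2, h3⟩ := hΩF x hx
      by_contra! h4
      exact h3 (Finset.mem_filter.2 ⟨h1, h2, y, hy, h4⟩)
    have hdisj : Disjoint E Ω := Finset.disjoint_right.2 fun x hx => (hΩF x hx).2.1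
    refine ⟨E ∪ Ω, Finset.union_subset hEF fun x hx => (hΩF x hx).1,
      fun x => if x ∈ E then 0 else c x + 1, ?_, ?_, ?_⟩
    · intro x hx y hy hxy
      by_cases hxE : x ∈ E <;> by_cases hyE : y ∈ E <;> simp [hxE, hyE] at hxy hx hy
      · exact hdiam x hxE y hyE
      · exact hc1 x hx y hy hxy
    · intro x hx y hy hxy
      by_cases hxE : x ∈ E <;> by_cases hyE : y ∈ E <;> simp [hxE, hyE] at hxy hx hy
      · rw [dist_comm]
        exact hfar y hy x hxE
      · exact hfar x hx y hyE
      · exact hc2 x hx y hy hxy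
    · rw [← Finset.sum_sdiff hEBF, Finset.sum_union hEB, Finset.sum_union hdisj]
      linarith

end Sparsification

/-- A choice of signs for which a sum of vectors is no longer than if they were orthogonal. -/
theorem exists_sign_norm_sq_le {ι E : Type*} [DecidableEq ι] [NormedAddCommGroup E]
    [InnerProductSpace ℂ E] (J : Finset ι) (w : ι → E) :
    ∃ I ⊆ J, ‖∑ i ∈ I, w i - ∑ i ∈ J \ I, w i‖ ^ 2 ≤ ∑ i ∈ J, ‖w i‖ ^ 2 := by
  induction J using Finset.induction_on with
  | empty => exact ⟨∅, subset_rfl, by simp⟩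
  | insert j J hj ih =>
    obtain ⟨I, hI, h⟩ := ih
    have hjI : j ∉ I := fun h => hj (hI h)
    set a := ∑ i ∈ I, w i - ∑ i ∈ J \ I, w i with ha
    -- The shorter of a + w j and a - w j has squared norm at most ‖a‖² + ‖w j‖².
    have hpar := parallelogram_law_with_norm ℂ a (w j)
    rw [Finset.sum_insert hj]
    rcases le_total (‖a + w j‖ * ‖a + w j‖) (‖a - w j‖ * ‖a - w j‖) with h1 | h1
    · refine ⟨insert j I, Finset.insert_subset_insert j hI, ?_⟩
      rw [Finset.insert_sdiff_insert, Finset.sdiff_insert_of_notMem hj, Finset.sum_insert hjI]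
      have h2 : w j + ∑ i ∈ I, w i - ∑ i ∈ J \ I, w i = a + w j := by
        rw [ha]
        abel
      rw [h2]
      nlinarith
    · refine ⟨I, hI.trans (Finset.subset_insert _ _), ?_⟩
      rw [Finset.insert_sdiff_of_notMem _ hjI, Finset.sum_insert (by simp [hj])]
      have h2 : ∑ i ∈ I, w i - (w j + ∑ i ∈ J \ I, w i) = a - w j := by
        rw [ha]
        abel
      rw [h2]
      nlinarith

/-! ### Vector fields from property A -/

/-- The normalised indicator functions of the sets of property A. -/
theorem PropertyA.exists_unit_vectors {X : Type*} [MetricSpace X] (hA : PropertyA X) {r θ : ℝ}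
    (hr : 0 < r) (hθ : 0 < θ) :
    ∃ (ξ : X → lp (fun _ : X × ℕ => ℂ) 2) (S : ℝ), (∀ x, ‖ξ x‖ = 1) ∧
      (∀ x y, dist x y ≤ r → ‖ξ x - ξ y‖ ≤ θ) ∧
      ∀ x y, S < dist x y → inner ℂ (ξ x) (ξ y) = 0 := by
  classical
  -- For unit vectors ‖ξ x - ξ y‖² = 2 - 2 Re ⟪ξ x, ξ y⟫, so the inner product must be at least 1 -
  -- θ²/2.
  obtain ⟨A, hfin, hmem, hsd, S, hS, hdiam⟩ := hA r (θ ^ 2 / 2) hr (by positivity)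
  obtain ⟨a, rfl⟩ : ∃ a : X → Finset (X × ℕ), A = fun x => (a x : Set (X × ℕ)) :=
    ⟨fun x => (hfin x).toFinset, by simp⟩
  simp only [Finset.mem_coe] at hmem hdiam
  have hpos : ∀ x, (0 : ℝ) < (a x).card := fun x => by
    exact_mod_cast Finset.card_pos.2 ⟨_, hmem x⟩
  let ζ : X → lp (fun _ : X × ℕ => ℂ) 2 := fun x => ∑ p ∈ a x, lp.single 2 p (1 : ℂ)
  have hinner : ∀ x y, inner ℂ (ζ x) (ζ y) = ((a x ∩ a y).card : ℂ) := by
    intro x y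
    simp only [ζ, sum_inner, inner_sum]
    have h1 : ∀ p q : X × ℕ, inner ℂ (lp.single 2 p (1 : ℂ) : lp (fun _ : X × ℕ => ℂ) 2)
        (lp.single 2 q (1 : ℂ)) = if p = q then 1 else 0 := by
      intro p q
      rw [lp.inner_single_left]
      by_cases h : p = q
      · subst h
        simp
      · simp [h]
    simp only [h1, Finset.sum_ite_eq']
    rw [Finset.sum_ite_mem, Finset.inter_comm]
    simp
  let ξ : X → lp (fun _ : X × ℕ => ℂ) 2 := fun x => (((Real.sqrt (a x).card)⁻¹ : ℝ) : ℂ) • ζ x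
  have hξ : ∀ x y, inner ℂ (ξ x) (ξ y) =
      (((a x ∩ a y).card / (Real.sqrt (a x).card * Real.sqrt (a y).card) : ℝ) : ℂ) := by
    intro x y
    simp only [ξ]
    rw [inner_smul_left, inner_smul_right, hinner, Complex.conj_ofReal]
    push_cast
    rw [div_eq_mul_inv, mul_inv]
    ring
  have hnorm : ∀ x, ‖ξ x‖ = 1 := by
    intro x
    have h := inner_self_eq_norm_sq_to_K (𝕜 := ℂ) (ξ x)
    rw [hξ, Finset.inter_self, Real.mul_self_sqrt (hpos x).le, div_self (hpos x).ne'] at h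
    have h2 : (1 : ℝ) = ‖ξ x‖ ^ 2 := Complex.ofReal_injective (by push_cast at h ⊢; exact h)
    nlinarith [norm_nonneg (ξ x)]
  refine ⟨ξ, 2 * S, hnorm, fun x y hxy => ?_, fun x y hxy => ?_⟩
  · have h := hsd x y hxy
    rw [← Finset.coe_symmDiff, ← Finset.coe_inter, Set.ncard_coe_finset, Set.ncard_coe_finset] at h
    set i : ℝ := ((a x ∩ a y).card : ℝ) with hi
    have hle : ∀ z, z = x ∨ z = y → ((a z).card : ℝ) ≤ (1 + θ ^ 2 / 2) * i := by
      intro z hz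
      have h1 : a z ⊆ (a x ∩ a y) ∪ symmDiff (a x) (a y) := by
        intro p hp
        simp only [Finset.mem_union, Finset.mem_inter, Finset.mem_symmDiff]
        rcases hz with rfl | rfl <;> tauto
      have h2 : ((a z).card : ℝ) ≤ (a x ∩ a y).card + (symmDiff (a x) (a y)).card := by
        exact_mod_cast (Finset.card_le_card h1).trans (Finset.card_union_le _ _)
      linarith
    have hprod : Real.sqrt (a x).card * Real.sqrt (a y).card ≤ (1 + θ ^ 2 / 2) * i := by
      have h1 := Real.sqrt_le_sqrt (hle x (Or.inl rfl))
      have h2 := Real.sqrt_le_sqrt (hle y (Or.inr rfl))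
      calc _ ≤ Real.sqrt ((1 + θ ^ 2 / 2) * i) * Real.sqrt ((1 + θ ^ 2 / 2) * i) := by gcongr
        _ = _ := Real.mul_self_sqrt (by positivity)
    have hq : 0 < Real.sqrt (a x).card * Real.sqrt (a y).card :=
      mul_pos (Real.sqrt_pos.2 (hpos x)) (Real.sqrt_pos.2 (hpos y))
    -- With t = θ²/2 this is 1/(1 + t) ≥ 1 - t.
    have hcos : 1 - θ ^ 2 / 2 ≤ i / (Real.sqrt (a x).card * Real.sqrt (a y).card) := by
      rw [le_div_iff₀ hq]
      have hi0 : 0 ≤ i := by positivity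
      rcases le_total (1 - θ ^ 2 / 2) 0 with h0 | h0
      · nlinarith
      · calc _ ≤ (1 - θ ^ 2 / 2) * ((1 + θ ^ 2 / 2) * i) := by gcongr
          _ = (1 - (θ ^ 2 / 2) ^ 2) * i := by ring
          _ ≤ 1 * i := by
              gcongr
              nlinarith [sq_nonneg (θ ^ 2 / 2)]
          _ = i := one_mul i
    have hsq : ‖ξ x - ξ y‖ ^ 2 ≤ θ ^ 2 := by
      rw [norm_sub_sq (𝕜 := ℂ), hnorm, hnorm, hξ]
      simp only [RCLike.re_to_complex, Complex.ofReal_re]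
      linarith
    exact le_of_sq_le_sq hsq hθ.le
  · rw [hξ]
    have h : a x ∩ a y = ∅ := by
      rw [← Finset.disjoint_iff_inter_eq_empty, Finset.disjoint_left]
      intro p hp hp'
      have h1 := hdiam x p hp (x, 1) (hmem x)
      have h2 := hdiam y p hp' (y, 1) (hmem y)
      have h3 := dist_triangle_left x y p.1
      simp only at h1 h2
      linarith
    simp [h]

/-! ### Slicing operators on the tensor product -/

section Tensor

variable {H : Type*} [NormedAddCommGroup H] [InnerProductSpace ℂ H]
  {K : Type*} [NormedAddCommGroup K] [InnerProductSpace ℂ K]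

theorem tensorOp_comp_tens (T : H →L[ℂ] H) (k : K) :
    tensorOp T (.id ℂ K) ∘L tens k = tens k ∘L T := by
  ext v
  simp [tensorOp_tens]

variable [CompleteSpace H]

theorem tens_adjoint_comp_tens (k l : K) :
    (tens k : H →L[ℂ] HTensor H K).adjoint ∘L tens l = (inner ℂ k l : ℂ) • .id ℂ H := by
  ext v
  refine ext_inner_left ℂ fun w => ?_
  rw [ContinuousLinearMap.comp_apply, ContinuousLinearMap.adjoint_inner_right, inner_tens]
  simp [inner_smul_right, mul_comm]

variable [CompleteSpace K]

theorem tens_adjoint_comp_tensorOp (T : H →L[ℂ] H) (k : K) :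
    (tens k : H →L[ℂ] HTensor H K).adjoint ∘L tensorOp T (.id ℂ K) =
      T ∘L (tens k : H →L[ℂ] HTensor H K).adjoint := by
  have h := congrArg ContinuousLinearMap.adjoint (tensorOp_comp_tens T.adjoint k)
  simpa only [ContinuousLinearMap.adjoint_comp, tensorOp_adjoint, ContinuousLinearMap.adjoint_id,
    ContinuousLinearMap.adjoint_adjoint] using h

theorem norm_conj_sub_conj_le {E : Type*} [NormedAddCommGroup E] [InnerProductSpace ℂ E]
    [CompleteSpace E] {a b : H →L[ℂ] E} {S : E →L[ℂ] E} {θ t : ℝ} (ha : ‖a‖ ≤ 1) (hb : ‖b‖ ≤ 1)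
    (hab : ‖a - b‖ ≤ θ) (hS : ‖S‖ ≤ t) :
    ‖a.adjoint ∘L S ∘L a - b.adjoint ∘L S ∘L b‖ ≤ 2 * θ * t := by
  have h : a.adjoint ∘L S ∘L a - b.adjoint ∘L S ∘L b =
      a.adjoint ∘L S ∘L (a - b) + (a - b).adjoint ∘L S ∘L b := by
    rw [map_sub, ContinuousLinearMap.sub_comp, ContinuousLinearMap.comp_sub,
      ContinuousLinearMap.comp_sub]
    abel
  have hθ : 0 ≤ θ := (norm_nonneg _).trans hab
  have ht : 0 ≤ t := (norm_nonneg _).trans hS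
  have hnorm : ∀ c d : H →L[ℂ] E, ‖c.adjoint ∘L S ∘L d‖ ≤ ‖c‖ * (‖S‖ * ‖d‖) := fun c d =>
    (ContinuousLinearMap.opNorm_comp_le _ _).trans (by
      rw [LinearIsometryEquiv.norm_map]
      gcongr
      exact ContinuousLinearMap.opNorm_comp_le _ _)
  rw [h]
  calc _ ≤ ‖a‖ * (‖S‖ * ‖a - b‖) + ‖a - b‖ * (‖S‖ * ‖b‖) :=
        (norm_add_le _ _).trans (add_le_add (hnorm _ _) (hnorm _ _))
    _ ≤ 1 * (t * θ) + θ * (t * 1) := by gcongr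
    _ = _ := by ring

end Tensor

namespace XModule

variable {X : Type*} [MetricSpace X]
  {H : Type*} [NormedAddCommGroup H] [InnerProductSpace ℂ H] [CompleteSpace H]
  (M : XModule X H)

/-! ### Compression of T ⊗ Id by a vector field -/

section Embedding

variable {K : Type*} [NormedAddCommGroup K] [InnerProductSpace ℂ K]

variable {M} {ξ : X → K} {V : H →L[ℂ] HTensor H K}

theorem chi_comp_field_operator_adjoint' (hV : ∀ x, V ∘L M.chi {x} = tens (ξ x) ∘L M.chi {x})
    (x : X) :
    M.chi {x} ∘L V.adjoint = M.chi {x} ∘L (tens (ξ x) : H →L[ℂ] HTensor H K).adjoint := by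
  have h := congrArg ContinuousLinearMap.adjoint (hV x)
  simpa [ContinuousLinearMap.adjoint_comp, chi_adjoint] using h

theorem norm_compression_le (hV1 : ‖V‖ ≤ 1) (T : H →L[ℂ] H) :
    ‖V.adjoint ∘L tensorOp T (.id ℂ K) ∘L V‖ ≤ ‖T‖ := by
  calc _ ≤ ‖V‖ * (‖T‖ * ‖V‖) := by
        refine (ContinuousLinearMap.opNorm_comp_le _ _).trans ?_
        rw [LinearIsometryEquiv.norm_map]
        gcongr
        exact (ContinuousLinearMap.opNorm_comp_le _ _).trans
          (by gcongr; exact opNorm_tensorOp_id_le T)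
    _ ≤ 1 * (‖T‖ * 1) := by gcongr
    _ = ‖T‖ := by ring

section

variable [CompleteSpace K]

variable (M) in
/-- A bounded vector field `ξ` defines the operator `v ↦ ∑ x, χ_{x} v ⊗ ξ x`. -/
theorem exists_field_operator (ξ : X → K) {C : ℝ} (hC0 : 0 ≤ C) (hC : ∀ x, ‖ξ x‖ ≤ C) :
    ∃ V : H →L[ℂ] HTensor H K, ‖V‖ ≤ C ∧
      ∀ x, V ∘L M.chi {x} = tens (ξ x) ∘L M.chi {x} := by
  rcases subsingleton_or_nontrivial K with hK | hK
  · refine ⟨0, ContinuousLinearMap.opNorm_le_bound _ hC0 fun v => ?_, fun x => ?_⟩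
    · simpa using mul_nonneg hC0 (norm_nonneg v)
    ext v
    rw [Subsingleton.elim (ξ x) 0]
    simp [tens_zero]
  obtain ⟨e, he⟩ := exists_norm_eq K zero_le_one
  have hbd : ∀ x, ‖InnerProductSpace.rankOne ℂ (ξ x) e‖ ≤ C := fun x => by
    rw [InnerProductSpace.norm_rankOne, he, mul_one]
    exact hC x
  -- Sending v to v ⊗ e and then applying the block-diagonal operator that turns e into ξ x lets the
  -- bound on Λ control the norm of V.
  refine ⟨M.lambda (fun x => InnerProductSpace.rankOne ℂ (ξ x) e) ⟨C, hbd⟩ ∘L tens e, ?_, ?_⟩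
  · calc _ ≤ C * ‖e‖ := (ContinuousLinearMap.opNorm_comp_le _ _).trans
          (mul_le_mul (M.norm_lambda_le _ _ hC0 hbd) (norm_tens_le e) (norm_nonneg _) hC0)
      _ = C := by rw [he, mul_one]
  · intro x
    have h : tens e ∘L M.chi {x} = tensorOp (M.chi {x}) (.id ℂ K) ∘L tens e := by
      ext v
      simp [tensorOp_tens]
    rw [ContinuousLinearMap.comp_assoc, h, ← ContinuousLinearMap.comp_assoc,
      lambda_comp_chi_singleton]
    ext v
    simp [tensorOp_tens, he]

end

variable [DiscreteTopology X]

theorem field_operator_comp_chi (hV : ∀ x, V ∘L M.chi {x} = tens (ξ x) ∘L M.chi {x}) (A : Set X) :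
    V ∘L M.chi A = tensorOp (M.chi A) (.id ℂ K) ∘L V := by
  classical
  refine M.ext_chi fun x => ?_
  rw [ContinuousLinearMap.comp_assoc, ContinuousLinearMap.comp_assoc, hV,
    ← ContinuousLinearMap.comp_assoc (tensorOp _ _), tensorOp_comp_tens,
    ContinuousLinearMap.comp_assoc, chi_comp_singleton]
  split_ifs
  · exact hV x
  · simp

/-- The (x, y) block of the compression is ⟪ξ x, ξ y⟫ χ_x T χ_y. -/
theorem propagation_compression_lt_top (hV : ∀ x, V ∘L M.chi {x} = tens (ξ x) ∘L M.chi {x})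
    {S : ℝ} (hS : ∀ x y, S < dist x y → inner ℂ (ξ x) (ξ y) = 0) (T : H →L[ℂ] H) :
    M.propagation (V.adjoint ∘L tensorOp T (.id ℂ K) ∘L V) < ⊤ := by
  refine lt_of_le_of_lt (iSup₂_le ?_) (ENNReal.ofReal_lt_top (r := S))
  rintro ⟨x, y⟩ hxy
  rw [mem_support_iff] at hxy
  rw [edist_dist]
  refine ENNReal.ofReal_le_ofReal ?_
  by_contra! h
  refine hxy ?_
  have h1 : M.chi {x} ∘L (V.adjoint ∘L tensorOp T (.id ℂ K) ∘L V) ∘L M.chi {y} =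
      M.chi {x} ∘L ((tens (ξ x) : H →L[ℂ] HTensor H K).adjoint ∘L tens (ξ y)) ∘L
        T ∘L M.chi {y} := by
    simp only [ContinuousLinearMap.comp_assoc, hV]
    rw [← ContinuousLinearMap.comp_assoc (M.chi {x}), chi_comp_field_operator_adjoint' hV,
      ← ContinuousLinearMap.comp_assoc (tensorOp _ _), tensorOp_comp_tens]
    rfl
  rw [h1, tens_adjoint_comp_tens, hS x y h]
  simp

variable [CompleteSpace K]

theorem chi_comp_field_operator_adjoint (hV : ∀ x, V ∘L M.chi {x} = tens (ξ x) ∘L M.chi {x})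
    (A : Set X) :
    M.chi A ∘L V.adjoint = V.adjoint ∘L tensorOp (M.chi A) (.id ℂ K) := by
  have h := congrArg ContinuousLinearMap.adjoint (field_operator_comp_chi hV A)
  simpa only [ContinuousLinearMap.adjoint_comp, tensorOp_adjoint, chi_adjoint,
    ContinuousLinearMap.adjoint_id] using h

/-- Compressing `T ⊗ Id` by a field operator multiplies the blocks of `T` by inner products. -/
theorem chi_comp_compression_comp_chi (hV : ∀ x, V ∘L M.chi {x} = tens (ξ x) ∘L M.chi {x})
    (T : H →L[ℂ] H) (A B : Set X) :
    M.chi A ∘L (V.adjoint ∘L tensorOp T (.id ℂ K) ∘L V) ∘L M.chi B =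
      V.adjoint ∘L tensorOp (M.chi A ∘L T ∘L M.chi B) (.id ℂ K) ∘L V := by
  have h : tensorOp (M.chi A ∘L T ∘L M.chi B) (.id ℂ K) = tensorOp (M.chi A) (.id ℂ K) ∘L
      tensorOp T (.id ℂ K) ∘L tensorOp (M.chi B) (.id ℂ K) := by
    rw [tensorOp_comp_eq, tensorOp_comp_eq]
    rfl
  simp only [ContinuousLinearMap.comp_assoc, field_operator_comp_chi hV B, h]
  rw [← ContinuousLinearMap.comp_assoc (M.chi A), chi_comp_field_operator_adjoint hV,
    ContinuousLinearMap.comp_assoc]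

/-- Over a single point V agrees with `tens (ξ x)`, which intertwines T with T ⊗ Id, so the compact
factor χ_x T or T χ_x can be split off. -/
theorem isLocallyCompact_compression (hV : ∀ x, V ∘L M.chi {x} = tens (ξ x) ∘L M.chi {x})
    {T : H →L[ℂ] H} (hT : M.IsLocallyCompact T) :
    M.IsLocallyCompact (V.adjoint ∘L tensorOp T (.id ℂ K) ∘L V) := by
  rw [isLocallyCompact_iff] at hT ⊢
  intro x
  constructor
  · have h0 : (tens (ξ x) : H →L[ℂ] HTensor H K).adjoint ∘L tensorOp T (.id ℂ K) ∘L V =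
        T ∘L (tens (ξ x) : H →L[ℂ] HTensor H K).adjoint ∘L V := by
      rw [← ContinuousLinearMap.comp_assoc, tens_adjoint_comp_tensorOp,
        ContinuousLinearMap.comp_assoc]
    have h : M.chi {x} ∘L V.adjoint ∘L tensorOp T (.id ℂ K) ∘L V =
        (M.chi {x} ∘L T) ∘L (tens (ξ x) : H →L[ℂ] HTensor H K).adjoint ∘L V := by
      rw [← ContinuousLinearMap.comp_assoc, chi_comp_field_operator_adjoint' hV,
        ContinuousLinearMap.comp_assoc, h0]
      rfl
    rw [h]
    exact (hT x).1.comp_clm ((tens (ξ x) : H →L[ℂ] HTensor H K).adjoint ∘L V)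
  · have h : (V.adjoint ∘L tensorOp T (.id ℂ K) ∘L V) ∘L M.chi {x} =
        (V.adjoint ∘L tens (ξ x)) ∘L (T ∘L M.chi {x}) := by
      rw [ContinuousLinearMap.comp_assoc, ContinuousLinearMap.comp_assoc, hV,
        ← ContinuousLinearMap.comp_assoc (tensorOp _ _), tensorOp_comp_tens]
      rfl
    rw [h]
    exact (hT x).2.clm_comp (V.adjoint ∘L tens (ξ x))

/-- Compressing T ⊗ Id by the constant unit field k returns T exactly, and over N the field ξ is
within θ of k; each side of the compression contributes one θ. -/
theorem norm_chi_comp_sub_compression_comp_chi_le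
    (hV : ∀ x, V ∘L M.chi {x} = tens (ξ x) ∘L M.chi {x}) (hV1 : ‖V‖ ≤ 1) (T : H →L[ℂ] H)
    {N : Set X} {k : K} (hk : ‖k‖ = 1) {θ : ℝ} (hθ : 0 ≤ θ) (hN : ∀ x ∈ N, ‖k - ξ x‖ ≤ θ) :
    ‖M.chi N ∘L (T - V.adjoint ∘L tensorOp T (.id ℂ K) ∘L V) ∘L M.chi N‖ ≤ 2 * θ * ‖T‖ := by
  classical
  set W : H →L[ℂ] HTensor H K := tens k with hW
  have h1 : M.chi N ∘L (T - V.adjoint ∘L tensorOp T (.id ℂ K) ∘L V) ∘L M.chi N =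
      (W ∘L M.chi N).adjoint ∘L tensorOp T (.id ℂ K) ∘L (W ∘L M.chi N) -
        (V ∘L M.chi N).adjoint ∘L tensorOp T (.id ℂ K) ∘L (V ∘L M.chi N) := by
    have hT : T = W.adjoint ∘L tensorOp T (.id ℂ K) ∘L W := by
      rw [hW, tensorOp_comp_tens, ← ContinuousLinearMap.comp_assoc, tens_adjoint_comp_tens,
        inner_self_eq_norm_sq_to_K, hk]
      simp
    rw [ContinuousLinearMap.adjoint_comp, ContinuousLinearMap.adjoint_comp, chi_adjoint,
      ContinuousLinearMap.sub_comp, ContinuousLinearMap.comp_sub]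
    conv_lhs => enter [1]; rw [hT]
    rfl
  obtain ⟨D, hD, hDx⟩ := M.exists_field_operator (fun x => if x ∈ N then k - ξ x else 0) hθ
    (fun x => by
      split_ifs with h
      · exact hN x h
      · simpa using hθ)
  -- The difference is again a field operator, so its norm is bounded by the supremum of ‖k - ξ x‖
  -- over N.
  have h2 : W ∘L M.chi N - V ∘L M.chi N = D := by
    refine M.ext_chi fun x => ?_
    rw [hDx, ContinuousLinearMap.sub_comp, ContinuousLinearMap.comp_assoc,
      ContinuousLinearMap.comp_assoc, chi_comp_singleton]
    split_ifs
    · rw [hV]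
      ext v
      simp [hW, tens_sub]
    · ext v
      simp [tens_zero]
  have h3 : ∀ U : H →L[ℂ] HTensor H K, ‖U‖ ≤ 1 → ‖U ∘L M.chi N‖ ≤ 1 := fun U hU =>
    (ContinuousLinearMap.opNorm_comp_le _ _).trans
      (mul_le_one₀ hU (norm_nonneg _) (M.norm_chi_le N))
  rw [h1]
  exact norm_conj_sub_conj_le (h3 W ((norm_tens_le k).trans hk.le)) (h3 V hV1) (by rwa [h2])
    (opNorm_tensorOp_id_le T)

end Embedding
end XModule

namespace XModule

variable {X : Type*} [MetricSpace X] [DiscreteTopology X]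
  {H : Type*} [NormedAddCommGroup H] [InnerProductSpace ℂ H] [CompleteSpace H]
  (M : XModule X H)

/-! ### Localization of quasi-local operators -/

theorem chi_add_chi_compl (A : Set X) : M.chi A + M.chi Aᶜ = .id ℂ H := by
  classical
  refine M.ext_chi fun x => ?_
  rw [ContinuousLinearMap.add_comp, chi_comp_singleton, chi_comp_singleton]
  by_cases hx : x ∈ A <;> simp [hx]

theorem norm_sq_chi_finset (F : Finset X) (v : H) :
    ‖M.chi F v‖ ^ 2 = ∑ x ∈ F, ‖M.chi {x} v‖ ^ 2 := by
  classical
  have hin : ∀ x y, inner ℂ (M.chi {x} v) (M.chi {y} v) =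
      if x = y then ((‖M.chi {x} v‖ ^ 2 : ℝ) : ℂ) else 0 := by
    intro x y
    split_ifs with h
    · subst h
      rw [inner_self_eq_norm_sq_to_K]
      simp
    · conv_lhs => rw [← M.chi_adjoint {x}, ContinuousLinearMap.adjoint_inner_left,
        ← ContinuousLinearMap.comp_apply, M.chi_comp_of_disjoint (Set.disjoint_singleton.2 h)]
      simp
  have h := inner_self_eq_norm_sq_to_K (𝕜 := ℂ) (M.chi F v)
  rw [chi_finset, sum_apply] at h ⊢
  simp only [sum_inner, inner_sum, hin, Finset.sum_ite_eq'] at h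
  rw [Finset.sum_ite_mem, Finset.inter_self] at h
  apply Complex.ofReal_injective
  push_cast at h ⊢
  exact h.symm

/-- Let N be the R-neighbourhood of U, which stays at distance at least R from U'. Up to ε, B χ_U v
is supported in N and B χ_U' v off N. -/
theorem norm_inner_map_chi_le {B : H →L[ℂ] H} {b ε R : ℝ} (hb : ‖B‖ ≤ b)
    (hB : M.HasPropagation B ε R) {U U' : Set X} (hU : ∀ x ∈ U, ∀ y ∈ U', 2 * R ≤ dist x y)
    (v : H) : ‖(inner ℂ (B (M.chi U v)) (B (M.chi U' v)) : ℂ)‖ ≤ 2 * ε * b * ‖v‖ ^ 2 := by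
  set N : Set X := {x | ∃ y ∈ U, dist x y < R} with hN
  have hb0 : 0 ≤ b := (norm_nonneg _).trans hb
  have h1 : ‖M.chi Nᶜ (B (M.chi U v))‖ ≤ ε * ‖v‖ :=
    (M.chi Nᶜ ∘L B ∘L M.chi U).le_of_opNorm_le (hB _ _ fun x hx y hy => by
      by_contra! h
      exact hx ⟨y, hy, h⟩).le v
  have h2 : ‖M.chi N (B (M.chi U' v))‖ ≤ ε * ‖v‖ :=
    (M.chi N ∘L B ∘L M.chi U').le_of_opNorm_le (hB _ _ fun x hx y hy => by
      obtain ⟨z, hz, hxz⟩ := hx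
      have := hU z hz y hy
      have := dist_triangle_left z y x
      linarith).le v
  have hbv : ∀ W : Set X, ‖B (M.chi W v)‖ ≤ b * ‖v‖ := fun W =>
    (B.le_of_opNorm_le hb _).trans (by gcongr; exact M.norm_chi_apply_le W v)
  have h3 : (inner ℂ (B (M.chi U v)) (B (M.chi U' v)) : ℂ) =
      inner ℂ (B (M.chi U v)) (M.chi N (B (M.chi U' v))) +
        inner ℂ (M.chi Nᶜ (B (M.chi U v))) (B (M.chi U' v)) := by
    have h4 := congrArg (fun S : H →L[ℂ] H => S (B (M.chi U v))) (M.chi_add_chi_compl N)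
    simp only [add_apply, ContinuousLinearMap.id_apply] at h4
    conv_lhs => rw [← h4]
    rw [inner_add_left, ← ContinuousLinearMap.adjoint_inner_right, chi_adjoint]
  rw [h3]
  calc _ ≤ (b * ‖v‖) * (ε * ‖v‖) + (ε * ‖v‖) * (b * ‖v‖) := by
        refine (norm_add_le _ _).trans (add_le_add ?_ ?_)
        · exact (norm_inner_le_norm _ _).trans
            (mul_le_mul (hbv U) h2 (norm_nonneg _) (by positivity))
        · exact (norm_inner_le_norm _ _).trans
            (mul_le_mul h1 (hbv U') (norm_nonneg _) ((norm_nonneg _).trans h1))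
    _ = _ := by ring

/-- An operator with small propagation is almost block diagonal on vectors supported on a union of
sets that are far away from each other. -/
theorem norm_sq_map_chi_le {B : H →L[ℂ] H} {b ε R β : ℝ} (hb : ‖B‖ ≤ b)
    (hB : M.HasPropagation B ε R) (Ω : Finset X) (c : X → ℕ)
    (hc : ∀ x ∈ Ω, ∀ y ∈ Ω, c x ≠ c y → 2 * R ≤ dist x y)
    (hβ : ∀ i, ‖B ∘L M.chi {x | x ∈ Ω ∧ c x = i}‖ ≤ β) (v : H) :
    ‖B (M.chi Ω v)‖ ^ 2 ≤ (β ^ 2 + 8 * ε * b) * ‖v‖ ^ 2 := by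
  classical
  let Ωi : ℕ → Finset X := fun i => Ω.filter fun x => c x = i
  have hΩi : ∀ i, {x | x ∈ Ω ∧ c x = i} = (Ωi i : Set X) := fun i => by
    ext x
    simp [Ωi]
  simp only [hΩi] at hβ
  set J := Ω.image c with hJ
  have hsum : ∀ I : Finset ℕ, I ⊆ J →
      ∑ i ∈ I, B (M.chi (Ωi i) v) = B (M.chi (Ω.filter fun x => c x ∈ I) v) := by
    intro I hI
    rw [← map_sum]
    congr 1
    simp only [chi_finset, sum_apply]
    rw [← Finset.sum_fiberwise_of_maps_to (s := Ω.filter fun x => c x ∈ I) (t := I) (g := c)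
      (fun x hx => (Finset.mem_filter.1 hx).2)]
    refine Finset.sum_congr rfl fun i hi => Finset.sum_congr ?_ fun _ _ => rfl
    ext x
    simp only [Ωi, Finset.mem_filter]
    exact ⟨fun h => ⟨⟨h.1, h.2 ▸ hi⟩, h.2⟩, fun h => ⟨h.1.1, h.2⟩⟩
  -- Summing cross terms over all pairs of pieces would give no uniform bound. The signs group the
  -- pieces into two distant sets, leaving a single cross term.
  obtain ⟨I, hI, hsign⟩ := exists_sign_norm_sq_le J fun i => B (M.chi (Ωi i) v)
  have hfull : B (M.chi Ω v) = ∑ i ∈ I, B (M.chi (Ωi i) v) + ∑ i ∈ J \ I, B (M.chi (Ωi i) v) := by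
    rw [add_comm, Finset.sum_sdiff hI, hsum J subset_rfl, Finset.filter_true_of_mem]
    exact fun x hx => Finset.mem_image_of_mem c hx
  have hcross : ‖(inner ℂ (∑ i ∈ I, B (M.chi (Ωi i) v))
      (∑ i ∈ J \ I, B (M.chi (Ωi i) v)) : ℂ)‖ ≤ 2 * ε * b * ‖v‖ ^ 2 := by
    rw [hsum I hI, hsum _ Finset.sdiff_subset]
    refine M.norm_inner_map_chi_le hb hB (fun x hx y hy => ?_) v
    simp only [Finset.coe_filter, Finset.mem_sdiff, Set.mem_ofPred_eq] at hx hy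
    exact hc x hx.1 y hy.1 fun h => hy.2.2 (h ▸ hx.2)
  have hdiag : ∑ i ∈ J, ‖B (M.chi (Ωi i) v)‖ ^ 2 ≤ β ^ 2 * ‖v‖ ^ 2 := by
    have h1 : ∀ i, ‖B (M.chi (Ωi i) v)‖ ^ 2 ≤ β ^ 2 * ‖M.chi (Ωi i) v‖ ^ 2 := by
      intro i
      rw [← mul_pow]
      gcongr
      have h2 := (B ∘L M.chi (Ωi i)).le_of_opNorm_le (hβ i) (M.chi (Ωi i) v)
      rwa [ContinuousLinearMap.comp_apply, ← ContinuousLinearMap.comp_apply (M.chi _),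
        chi_comp_self] at h2
    calc _ ≤ ∑ i ∈ J, β ^ 2 * ‖M.chi (Ωi i) v‖ ^ 2 := Finset.sum_le_sum fun i _ => h1 i
      _ = β ^ 2 * ‖M.chi Ω v‖ ^ 2 := by
          rw [← Finset.mul_sum, norm_sq_chi_finset,
            ← Finset.sum_fiberwise_of_maps_to (t := J) (g := c)
              (fun x hx => Finset.mem_image_of_mem c hx)]
          simp only [norm_sq_chi_finset, Ωi]
      _ ≤ _ := by
          gcongr
          exact M.norm_chi_apply_le _ v
  rw [hfull]
  set p := ∑ i ∈ I, B (M.chi (Ωi i) v)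
  set q := ∑ i ∈ J \ I, B (M.chi (Ωi i) v)
  have h1 := norm_add_sq (𝕜 := ℂ) p q
  -- ‖p + q‖² = ‖p - q‖² + 4 Re ⟪p, q⟫, whence 4 · 2εb = 8εb.
  have h2 := norm_sub_sq (𝕜 := ℂ) p q
  have h3 := (Complex.re_le_norm (inner ℂ p q)).trans hcross
  simp only [RCLike.re_to_complex] at h1 h2
  linarith

/-- On a space with bounded geometry and property A, the norms of operators with uniformly
controlled propagation can be estimated locally. -/
theorem norm_le_of_norm_ball_le (hX : BoundedGeometry X) (hA : PropertyA X) {b η : ℝ} (hb : 0 < b)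
    (hη : 0 < η) :
    ∃ ε : ℝ, 0 < ε ∧ ∀ R : ℝ, 0 < R → ∃ r : ℝ, 0 < r ∧ ∀ B : H →L[ℂ] H, ‖B‖ ≤ b →
      M.HasPropagation B ε R →
      (∀ x, ‖M.chi (Metric.ball x r) ∘L B ∘L M.chi (Metric.ball x r)‖ ≤ η / 8) → ‖B‖ ≤ η := by
  classical
  -- The first bound controls leakage out of a ball (β = η/8 + η/8), the second the cross term;
  -- together β² + 8εb ≤ η²/8 ≤ (η/2)².
  set ε := min (η / 8) (η ^ 2 / (128 * b)) with hε
  have hε0 : 0 < ε := lt_min (by positivity) (by positivity)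
  have hε1 : ε ≤ η / 8 := min_le_left _ _
  have hε2 : 8 * ε * b ≤ η ^ 2 / 16 := by
    have : ε ≤ η ^ 2 / (128 * b) := min_le_right _ _
    rw [le_div_iff₀ (by positivity)] at this
    linarith
  refine ⟨ε, hε0, fun R hR => ?_⟩
  -- The discarded part of v has norm at most s‖v‖ and so contributes at most bs‖v‖ = (η/2)‖v‖.
  set s := η / (2 * b) with hs
  have hs0 : 0 < s := by positivity
  obtain ⟨S, hS, hsparse⟩ := hA.exists_sparse hX (R := 2 * R) (κ := s ^ 2) (by positivity)
    (by positivity)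
  -- A piece lies within S of any of its points, so the complement of this ball is at distance at
  -- least R from it.
  refine ⟨S + R + 1, by positivity, fun B hBb hB hloc => ?_⟩
  have hfin : ∀ (v : H) (F : Finset X), ‖B (M.chi F v)‖ ≤ η * ‖v‖ := by
    intro v F
    obtain ⟨Ω, hΩ, c, hc1, hc2, hc3⟩ := hsparse (fun x => ‖M.chi {x} v‖ ^ 2)
      (fun x => sq_nonneg _) F
    have hβ : ∀ i, ‖B ∘L M.chi {x | x ∈ Ω ∧ c x = i}‖ ≤ η / 4 := by
      intro i
      set U : Set X := {x | x ∈ Ω ∧ c x = i} with hU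
      rcases U.eq_empty_or_nonempty with h0 | ⟨x0, hx0⟩
      · have h1 : M.chi (∅ : Set X) = 0 := by simpa using M.chi_finset ∅
        rw [h0, h1, ContinuousLinearMap.comp_zero, norm_zero]
        positivity
      set N := Metric.ball x0 (S + R + 1) with hN
      have hdist : ∀ x ∈ U, dist x x0 ≤ S := fun x hx =>
        hc1 x hx.1 x0 hx0.1 (hx.2.trans hx0.2.symm)
      have hUN : U ⊆ N := fun x hx => by
        rw [hN, Metric.mem_ball]
        linarith [hdist x hx]
      have h1 : B ∘L M.chi U = (M.chi N ∘L B ∘L M.chi N) ∘L M.chi U +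
          M.chi Nᶜ ∘L B ∘L M.chi U := by
        rw [ContinuousLinearMap.comp_assoc, ContinuousLinearMap.comp_assoc,
          M.chi_comp_of_subset_right hUN, ← ContinuousLinearMap.add_comp, chi_add_chi_compl,
          ContinuousLinearMap.id_comp]
      have h2 : ‖(M.chi N ∘L B ∘L M.chi N) ∘L M.chi U‖ ≤ η / 8 * 1 :=
        (ContinuousLinearMap.opNorm_comp_le _ _).trans
          (mul_le_mul (hloc x0) (M.norm_chi_le U) (norm_nonneg _) (by positivity))
      have h3 : ‖M.chi Nᶜ ∘L B ∘L M.chi U‖ < ε := by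
        refine hB _ _ fun x hx y hy => ?_
        rw [hN, Set.mem_compl_iff, Metric.mem_ball, not_lt] at hx
        have := dist_triangle x y x0
        linarith [hdist y hy]
      rw [h1]
      refine (norm_add_le _ _).trans ?_
      linarith
    have h1 := M.norm_sq_map_chi_le hBb hB Ω c hc2 hβ v
    have h2 : ‖B (M.chi Ω v)‖ ≤ η / 2 * ‖v‖ := by
      refine le_of_sq_le_sq (h1.trans ?_) (by positivity)
      rw [mul_pow]
      gcongr
      nlinarith only [hε2, sq_nonneg η]
    have h3 : ‖M.chi (F \ Ω : Finset X) v‖ ≤ s * ‖v‖ := by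
      refine le_of_sq_le_sq ?_ (by positivity)
      rw [norm_sq_chi_finset, mul_pow]
      have h4 := Finset.sum_sdiff (f := fun x => ‖M.chi {x} v‖ ^ 2) hΩ
      have h5 : ∑ x ∈ Ω, ‖M.chi {x} v‖ ^ 2 ≤ ‖v‖ ^ 2 := by
        rw [← norm_sq_chi_finset]
        gcongr
        exact M.norm_chi_apply_le _ v
      have h6 := mul_le_mul_of_nonneg_left h5 (sq_nonneg s)
      linarith
    have h4 : M.chi F v = M.chi (F \ Ω : Finset X) v + M.chi Ω v := by
      simp only [chi_finset, sum_apply]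
      exact (Finset.sum_sdiff hΩ).symm
    rw [h4, map_add]
    calc _ ≤ b * (s * ‖v‖) + η / 2 * ‖v‖ := by
          refine (norm_add_le _ _).trans (add_le_add ?_ h2)
          exact (B.le_of_opNorm_le hBb _).trans (by gcongr)
      _ = η * ‖v‖ := by
          rw [hs]
          field_simp
          ring
  refine ContinuousLinearMap.opNorm_le_bound _ hη.le fun v => ?_
  have h1 := (B.hasSum (M.hasSum_chi v)).norm
  refine le_of_tendsto h1 (Filter.Eventually.of_forall fun F => ?_)
  have h2 := hfin v F
  rwa [chi_finset, sum_apply, map_sum] at h2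

theorem quasiLocal_subset_roe (hX : BoundedGeometry X) (hA : PropertyA X) :
    M.quasiLocal ⊆ M.roe := by
  intro T hT
  refine Metric.mem_closure_iff.2 fun η' hη' => ?_
  obtain ⟨η, hη, hηη'⟩ := exists_between hη'
  set b := 2 * ‖T‖ + 1 with hb
  have hb0 : 0 < b := by positivity
  obtain ⟨ε, hε, h⟩ := M.norm_le_of_norm_ball_le hX hA hb0 hη
  -- T and its compression each account for ε/2 of the off-diagonal bound on their difference.
  obtain ⟨R, hR, hTR⟩ := hT.2 (ε / 2) (by positivity)
  obtain ⟨r, hr, h⟩ := h R hR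
  -- Makes the local error 2θ‖T‖ at most η/8, because 2‖T‖ ≤ b.
  set θ := η / (8 * b) with hθ
  have hθ0 : 0 < θ := by positivity
  obtain ⟨ξ, S, hξ1, hξ2, hξ3⟩ := hA.exists_unit_vectors hr hθ0
  obtain ⟨V, hV1, hV⟩ := M.exists_field_operator ξ zero_le_one fun x => (hξ1 x).le
  refine ⟨V.adjoint ∘L tensorOp T (.id ℂ _) ∘L V, ⟨isLocallyCompact_compression hV hT.1,
    propagation_compression_lt_top hV hξ3 T⟩, ?_⟩
  rw [dist_eq_norm]
  refine (h _ ?_ ?_ ?_).trans_lt hηη'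
  · refine (norm_sub_le _ _).trans ?_
    have := norm_compression_le hV1 T
    linarith
  · intro A B hAB
    have h1 := hTR A B hAB
    have h2 := norm_compression_le hV1 (M.chi A ∘L T ∘L M.chi B)
    rw [← chi_comp_compression_comp_chi hV] at h2
    rw [ContinuousLinearMap.sub_comp, ContinuousLinearMap.comp_sub]
    refine (norm_sub_le _ _).trans_lt ?_
    linarith
  · intro x
    refine (norm_chi_comp_sub_compression_comp_chi_le hV hV1 T (hξ1 x) hθ0.le
      fun y hy => hξ2 x y ?_).trans ?_
    · rw [dist_comm]
      exact (Metric.mem_ball.1 hy).le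
    · rw [hθ]
      have h1 : 2 * ‖T‖ ≤ b := by linarith
      calc 2 * (η / (8 * b)) * ‖T‖ = η / 8 * (2 * ‖T‖ / b) := by
            field_simp
        _ ≤ η / 8 * 1 := by
            gcongr
            exact (div_le_one hb0).2 h1
        _ = η / 8 := mul_one _

end XModule

end RoeQL

end

theorem proposition3p3 {X : Type*} [MetricSpace X] [ProperSpace X] [DiscreteTopology X]
    {H : Type*} [NormedAddCommGroup H] [InnerProductSpace ℂ H] [CompleteSpace H]
    [TopologicalSpace.SeparableSpace H] (hH : ¬ FiniteDimensional ℂ H)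
    {K : Type*} [NormedAddCommGroup K] [InnerProductSpace ℂ K] [CompleteSpace K]
    [TopologicalSpace.SeparableSpace K] (hK : ¬ FiniteDimensional ℂ K)
    (M : RoeQL.XModule X H) (hM : M.IsAmple) :
    M.stronglyQuasiLocal K ⊆ M.quasiLocal ∧
    (RoeQL.BoundedGeometry X → M.roe ⊆ M.stronglyQuasiLocal K) ∧
    (RoeQL.BoundedGeometry X → RoeQL.PropertyA X →
      M.roe = M.stronglyQuasiLocal K ∧ M.stronglyQuasiLocal K = M.quasiLocal) := by
  have : Nontrivial K := by
    by_contra h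
    rw [not_nontrivial_iff_subsingleton] at h
    exact hK inferInstance
  have h1 : M.stronglyQuasiLocal K ⊆ M.quasiLocal := M.stronglyQuasiLocal_subset_quasiLocal
  refine ⟨h1, fun hX => M.roe_subset_stronglyQuasiLocal hX, fun hX hA => ?_⟩
  have h2 : M.roe ⊆ M.stronglyQuasiLocal K := M.roe_subset_stronglyQuasiLocal hX
  have h3 := M.quasiLocal_subset_roe hX hA
  exact ⟨h2.antisymm (h1.trans h3), h1.antisymm (h3.trans h2)⟩
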